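/- Let $k$ be an algebraically closed field of characteristic zero; a point of a $k$-scheme means a $k$-point. Let $\widehat U = U \rtimes \mathbb G_m$ be a graded unipotent group over $k$: $U$ is a unipotent group scheme (i.e. isomorphic to a closed subgroup scheme of the group of upper triangular $n\times n$ matrices with diagonal entries $1$, for some $n$), and $\mathbb G_m$ acts by conjugation on $\operatorname{Lie} U$ with strictly positive weights. Let $X$ be an affine scheme of finite type over $k$ with an action of $\widehat U$ such that 1. for every point $x$ of $X$ the limit $\lim_{t\to 0} t\cdot x$ exists (that is, the orbit map $\mathbb G_m \to X$, $t \mapsto t\cdot x$, extends to a morphism $\mathbb A^1 \to X$; the limit is the image of $0$), and 2. the scheme-theoretic stabiliser $\operatorname{Stab}_U(z)$ is trivial for every $z \in Z := \{\lim_{t\to 0} t\cdot x : x \text{ a point of } X\}$. Then the ring of invariants $\mathcal O(X)^U$ is a finitely generated $k$-algebra, and the morphism $X \to \operatorname{Spec} \mathcal O(X)^U$ given by the inclusion $\mathcal O(X)^U \subseteq \mathcal O(X)$ is a trivial $U$-quotient, i.e. a trivial principal $U$-bundle: there is an isomorphism $U \times \operatorname{Spec}\mathcal O(X)^U \cong X$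 over $\operatorname{Spec}\mathcal O(X)^U$ that is $U$-equivariant, where $U$ acts on $U \times \operatorname{Spec} \mathcal O(X)^U$ by left multiplication on the first factor. -/

import Mathlib

open CategoryTheory MonoidalCategory CartesianMonoidalCategory AlgebraicGeometry Limits
open scoped MonObj LaurentPolynomial

universe u

noncomputable section

namespace GradedUnipotent

/-- The category of schemes over the field `k`, with its cartesian monoidal structure given by
fibre products over `Spec k`. Group schemes over `k` are its group objects (`GrpObj`), actions of
a group scheme `G` on a `k`-scheme `X` are the instances of `ModObj G X`. For a `k`-scheme `T`, the
set `T ⟶ G` of `T`-points of a group scheme is a group and acts on the set `T ⟶ X`. The terminal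
object `𝟙_ (Sch k)` is `Spec k`, and a point (that is, a `k`-point) of `X` is a morphism
`𝟙_ (Sch k) ⟶ X`. -/
abbrev Sch (k : Type u) [Field k] := Over (Spec (CommRingCat.of k))

variable {k : Type u} [Field k]

/-! ### The affine line, the multiplicative group and the dual numbers -/

/-- `Spec A` as a `k`-scheme, for a commutative `k`-algebra `A`. -/
abbrev specOver (k : Type u) [Field k] (A : Type u) [CommRing A] [Algebra k A] : Sch k :=
  (Spec (CommRingCat.of A)).asOver (Spec (CommRingCat.of k))

/-- The morphism of `k`-schemes `Spec B ⟶ Spec A` given by a homomorphism of `k`-algebras. -/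
def specMap {A B : Type u} [CommRing A] [Algebra k A] [CommRing B] [Algebra k B]
    (f : A →ₐ[k] B) : specOver k B ⟶ specOver k A :=
  Over.homMk (Spec.map (CommRingCat.ofHom f.toRingHom)) (by
    change Spec.map _ ≫ Spec.map _ = Spec.map _
    rw [← Spec.map_comp, ← CommRingCat.ofHom_comp]
    congr 2
    exact f.comp_algebraMap)

/-- The `k`-point of `Spec A` given by a homomorphism of `k`-algebras `A → k`. -/
def specPoint {A : Type u} [CommRing A] [Algebra k A] (f : A →ₐ[k] k) :
    𝟙_ (Sch k) ⟶ specOver k A :=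
  Over.homMk (Spec.map (CommRingCat.ofHom f.toRingHom)) (by
    change Spec.map _ ≫ Spec.map _ = 𝟙 _
    rw [← Spec.map_comp, ← CommRingCat.ofHom_comp, ← Spec.map_id]
    congr 1
    ext x
    exact f.commutes x)

/-- The multiplicative group `𝔾ₘ = Spec k[T, T⁻¹]`; its group structure is the one that the Hopf
algebra structure with `T ↦ T ⊗ T` induces. -/
abbrev Gm (k : Type u) [Field k] : Sch k := specOver k k[T;T⁻¹]

/-- The `k`-point `t` of `𝔾ₘ`, for `t ∈ kˣ`. -/
def gmPoint (t : kˣ) : 𝟙_ (Sch k) ⟶ Gm k :=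
  specPoint { LaurentPolynomial.eval₂ (RingHom.id k) t with
    commutes' := fun a => LaurentPolynomial.eval₂_C (RingHom.id k) t a }

/-- The affine line `𝔸¹ = Spec k[T]`. -/
abbrev AffineLine (k : Type u) [Field k] : Sch k := specOver k (Polynomial k)

/-- The open immersion `𝔾ₘ ⟶ 𝔸¹` as the complement of the origin. -/
def gmToLine : Gm k ⟶ AffineLine k := specMap Polynomial.toLaurentAlg

/-- The origin of `𝔸¹`. -/
def lineZero : 𝟙_ (Sch k) ⟶ AffineLine k := specPoint (Polynomial.aeval (0 : k))

/-- The spectrum of the dual numbers `k[ε]`. -/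
abbrev SpecDual (k : Type u) [Field k] : Sch k := specOver k (DualNumber k)

/-- The closed point `Spec k ⟶ Spec k[ε]`, given by `ε ↦ 0`. -/
def dualPoint : 𝟙_ (Sch k) ⟶ SpecDual k := specPoint (TrivSqZeroExt.fstHom k k k)

/-- The endomorphism of `Spec k[ε]` given by `ε ↦ a ε`. -/
def dualScale (a : k) : SpecDual k ⟶ SpecDual k :=
  specMap (TrivSqZeroExt.map (a • LinearMap.id))

/-! ### Unipotent groups and graded unipotent groups -/

/-- The value of a matrix of functions on `U` at a `T`-point of `U`. -/
def matrixAt {U T : Sch k} {n : ℕ} (M : Matrix (Fin n) (Fin n) Γ(U.left, ⊤)) (g : T ⟶ U) :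
    Matrix (Fin n) (Fin n) Γ(T.left, ⊤) :=
  M.map g.left.appTop.hom

/-- A group scheme `U` is unipotent if it is isomorphic to a closed subgroup of the group of upper
triangular `n × n` matrices with diagonal entries equal to `1`, for some `n`. A homomorphism from
`U` to that group is a matrix `M` of functions on `U` which is upper triangular with diagonal
entries `1`, and multiplicative on `T`-points for every `T`. As the group is closed in the affine
space of `n × n` matrices, the homomorphism is a closed immersion if and only if the morphism from
`U` to that affine space is. -/
def IsUnipotent (U : Sch k) [GrpObj U] : Prop :=
  ∃ (n : ℕ) (M : Matrix (Fin n) (Fin n) Γ(U.left, ⊤)),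
    (∀ i, M i i = 1) ∧
    (∀ i j, j < i → M i j = 0) ∧
    (∀ (T : Sch k) (g h : T ⟶ U), matrixAt M (g * h) = matrixAt M g * matrixAt M h) ∧
    IsClosedImmersion (AffineSpace.homOfVector U.hom fun p : ULift.{u} (Fin n × Fin n) =>
      M p.down.1 p.down.2)

/-- The Lie algebra of a group scheme `U`: the kernel of `U(k[ε]) → U(k)`. Its addition is the
multiplication of `U(k[ε])`, and `a ∈ k` acts on it by precomposition with `dualScale a`. -/
def lie (U : Sch k) [GrpObj U] : Set (SpecDual k ⟶ U) :=
  {v | dualPoint ≫ v = 1}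

/-- The vectors of weight `n` in the Lie algebra of `U` for the conjugation action of
`lam : 𝔾ₘ ⟶ G`: those `v` with `lam(t) v lam(t)⁻¹ = tⁿ v` for all `t ∈ kˣ`. Here `U` is regarded
as a subgroup of `G` through `incl`. -/
def lieWeight {U G : Sch k} [GrpObj U] [GrpObj G] (incl : U ⟶ G) (lam : Gm k ⟶ G) (n : ℤ) :
    Set (SpecDual k ⟶ U) :=
  {v | v ∈ lie U ∧ ∀ t : kˣ,
    (toUnit _ ≫ gmPoint t ≫ lam) * (v ≫ incl) * (toUnit _ ≫ gmPoint t ≫ lam)⁻¹ =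
      (dualScale ((t ^ n : kˣ) : k) ≫ v) ≫ incl}

/-- `G` is a graded unipotent group `U ⋊ 𝔾ₘ`: through the homomorphisms `incl : U ⟶ G` and
`lam : 𝔾ₘ ⟶ G` it is the semi-direct product of the unipotent normal subgroup `U` and `𝔾ₘ`, and
`𝔾ₘ` acts on the Lie algebra of `U` by conjugation with strictly positive weights, that is, every
element of the Lie algebra is a finite sum of vectors of strictly positive weight. -/
structure IsGradedUnipotent {U G : Sch k} [GrpObj U] [GrpObj G] (incl : U ⟶ G) (lam : Gm k ⟶ G) :
    Prop where
  unipotent : IsUnipotent U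
  normal : IsMonHom.Normal incl
  isMonHom : IsMonHom lam
  /-- The morphism `U × 𝔾ₘ ⟶ G`, `(u, t) ↦ u t`, is an isomorphism of schemes. -/
  isIso : IsIso ((incl ⊗ₘ lam) ≫ μ[G])
  positive : ∀ v ∈ lie U, v ∈ Subgroup.closure {w | ∃ n : ℤ, 0 < n ∧ w ∈ lieWeight incl lam n}

/-! ### Orbit maps, stabilisers and limits -/

section Action

variable {H G X : Sch k} [GrpObj H] [GrpObj G] [ModObj G X]

variable (X) in
/-- The action of `H` on the `G`-scheme `X` through `f : H ⟶ G`. -/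
def actionVia (f : H ⟶ G) : H ⊗ X ⟶ X := f ▷ X ≫ γ[G, X]

/-- The orbit map `H ⟶ X`, `h ↦ f(h) x`, of a point `x`. -/
def orbitMap (f : H ⟶ G) (x : 𝟙_ (Sch k) ⟶ X) : H ⟶ X :=
  lift (𝟙 H) (toUnit H ≫ x) ≫ actionVia X f

/-- The stabiliser of the point `x` in `H`, i.e. the fibre product of the orbit map of `x` and
`x : Spec k ⟶ X`, is the trivial subgroup `e : Spec k ⟶ H`. -/
def HasTrivialStabilizer (f : H ⟶ G) (x : 𝟙_ (Sch k) ⟶ X) : Prop :=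
  IsPullback η[H] (𝟙 (𝟙_ (Sch k))) (orbitMap f x) x

/-- The limit of `t • x` as `t → 0` exists and is equal to `z`: the orbit map of `x` under `𝔾ₘ`
extends to a morphism `𝔸¹ ⟶ X` that maps `0` to `z`. -/
def IsLimitAtZero (lam : Gm k ⟶ G) (x z : 𝟙_ (Sch k) ⟶ X) : Prop :=
  ∃ f : AffineLine k ⟶ X, gmToLine ≫ f = orbitMap lam x ∧ lineZero ≫ f = z

/-- The set `Z` of all limits of `t • x` as `t → 0`, for `x` a point of `X`. -/
def limitSet (X : Sch k) [ModObj G X] (lam : Gm k ⟶ G) : Set (𝟙_ (Sch k) ⟶ X) :=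
  {z | ∃ x, IsLimitAtZero lam x z}

/-! ### Invariants and trivial quotients -/

variable (X) in
/-- The ring `𝒪(X)ᴴ` of invariant functions: those whose pullbacks along the action and along the
projection `H × X ⟶ X` agree. -/
def invariants (f : H ⟶ G) : Subring Γ(X.left, ⊤) :=
  (actionVia X f).left.appTop.hom.eqLocus (snd H X).left.appTop.hom

/-- The structure homomorphism `k → 𝒪(X)` of a `k`-scheme `X`. -/
def structureMap (X : Sch k) : k →+* Γ(X.left, ⊤) :=
  ((Scheme.ΓSpecIso (CommRingCat.of k)).inv ≫ X.hom.appTop).hom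

lemma comp_structureMap {X Y : Sch k} (g : X ⟶ Y) :
    g.left.appTop.hom.comp (structureMap Y) = structureMap X := by
  have h : Y.hom.appTop ≫ g.left.appTop = X.hom.appTop := by
    rw [← Scheme.Hom.comp_appTop, Over.w g]
  rw [structureMap, structureMap, ← h]
  rfl

variable (X) in
/-- The structure homomorphism `k → 𝒪(X)ᴴ`. -/
def invariantsStructureMap (f : H ⟶ G) : k →+* invariants X f :=
  (structureMap X).codRestrict (invariants X f) fun a => by
    change _ = _
    rw [← RingHom.comp_apply, ← RingHom.comp_apply, comp_structureMap, comp_structureMap]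

variable (X) in
/-- The `k`-scheme `Spec 𝒪(X)ᴴ`. -/
def specInvariants (f : H ⟶ G) : Sch k :=
  Over.mk (Spec.map (CommRingCat.ofHom (invariantsStructureMap X f)))

variable (X) in
/-- The morphism `X ⟶ Spec 𝒪(X)ᴴ` given by the inclusion `𝒪(X)ᴴ ⊆ 𝒪(X)`. -/
def quotientMap (f : H ⟶ G) : X ⟶ specInvariants X f :=
  Over.homMk (X.left.toSpecΓ ≫ Spec.map (CommRingCat.ofHom (invariants X f).subtype)) (by
    change (_ ≫ _) ≫ Spec.map _ = _
    rw [Category.assoc, ← Spec.map_comp, ← CommRingCat.ofHom_comp]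
    have h : (invariants X f).subtype.comp (invariantsStructureMap X f) = structureMap X := rfl
    rw [h]
    change X.left.toSpecΓ ≫ Spec.map ((Scheme.ΓSpecIso (CommRingCat.of k)).inv ≫ X.hom.appTop) = _
    have h' := Scheme.toSpecΓ_naturality X.hom
    rw [Spec.map_comp, ← Category.assoc]
    refine (congrArg (· ≫ Spec.map (Scheme.ΓSpecIso (CommRingCat.of k)).inv) h'.symm).trans ?_
    rw [Category.assoc]
    erw [toSpecΓ_SpecMap_ΓSpecIso_inv]
    exact Category.comp_id _)

/-- The morphism `q : X ⟶ Y` is a trivial `H`-quotient, i.e. a trivial principal `H`-bundle: there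
is an isomorphism `H × Y ≅ X` over `Y` which is equivariant for left multiplication of `H` on the
first factor of `H × Y`. -/
def IsTrivialQuotient (f : H ⟶ G) {Y : Sch k} (q : X ⟶ Y) : Prop :=
  ∃ e : H ⊗ Y ≅ X, e.hom ≫ q = snd H Y ∧
    H ◁ e.hom ≫ actionVia X f = (α_ H H Y).inv ≫ μ[H] ▷ Y ≫ e.hom

end Action

end GradedUnipotent

end

set_option linter.unusedSectionVars false

/-! Write `A` for the functions on `X` and `H` for the functions on `U`. Every point derivation `p`
of `H` at the identity, i.e. every element of `Lie U`, acts on `A` by a derivation `D_p` (`coDer`),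
and the action of `𝔾ₘ` grades `A`. Positivity gives a basis `p_j` of `Lie U` with weights `w_j > 0`;
since functions are pulled back, `D_j` lowers weights by `w_j`. Existence of limits means that a
function of negative weight vanishes at every point, so it is nilpotent; as `A` is finitely
generated, its weights are bounded below (`exists_weight_bound`).

Only the infinitesimal part of the stabiliser condition is needed: no nonzero tangent vector of `U`
fixes a limit point. This yields functions `f_j` of weight `w_j` such that, at every point, `D_i
f_j` equals `δ_ij` whenever `w_i = w_j` (`span_rows_eq_top`, `exists_weight_function`). At every
point the matrix `(D_i f_j)` is then block triangular with identity blocks, because its entries of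
negative weight vanish there; so it is invertible over `A` (`isUnit_det_derMatrix`). With its
inverse `W`, the derivations `∂_j = ∑ W_ji D_i` satisfy `∂_i f_j = δ_ij`. They commute, because
`[∂_i, ∂_j]` is again a combination of the `D_l` and kills every `f_m` (`sliceDer_commute`). They
are locally nilpotent, because they lower weights, which are bounded below (`exists_slices`).

In characteristic zero a locally nilpotent derivation `d` with `d f = 1` has the multiplicative
projection `a ↦ ∑ (-f)^m d^m a / m!` onto its constants. Composing these projections gives a
retraction `r` of `A` onto the common constants of the `∂_j`. These are the invariants, because a
function on a unipotent group killed by all the invariant derivations is constant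
(`eq_algebraMap_of_forall_coDer_eq_zero`). So `A^U` is a quotient of `A`, hence finitely generated,
and `r` is a section `s` of the quotient map. The comorphism of `(u, y) ↦ u • s(y)` is `orbitHom`,
from `A` to `H ⊗ A^U`. The `∂_j` have counterparts on the target that are again locally nilpotent
with slices, so bijectivity need only be checked on constants and slices
(`exists_retraction_bijective_orbitHom`). -/

namespace GradedUnipotent

/-! ### Locally nilpotent derivations with a slice -/

section Slice

variable {k R : Type*} [Field k] [CharZero k] [CommRing R] [Algebra k R]

/-- The `m`-th term of the projection of `a` to the constants of `d` along `f`. -/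
def sliceTerm (d : Derivation k R R) (f a : R) (m : ℕ) : R :=
  ((m.factorial : k)⁻¹) • ((-f) ^ m * d^[m] a)

/-- The projection to the constants of a locally nilpotent derivation `d` with `d f = 1`. -/
noncomputable def sliceProj (d : Derivation k R R) (f a : R) : R :=
  ∑ᶠ m, sliceTerm d f a m

lemma iterate_eq_zero_of_le {d : Derivation k R R} {a : R} {N m : ℕ} (h : d^[N] a = 0)
    (hm : N ≤ m) : d^[m] a = 0 := by
  obtain ⟨c, rfl⟩ := Nat.exists_eq_add_of_le' hm
  rw [Function.iterate_add_apply, h]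
  exact Function.iterate_fixed d.map_zero c

lemma sliceProj_eq {d : Derivation k R R} {a : R} {N : ℕ} (h : d^[N] a = 0) (f : R) :
    sliceProj d f a = ∑ m ∈ Finset.range N, sliceTerm d f a m := by
  refine finsum_eq_sum_of_support_subset _ fun m hm => ?_
  simp only [Finset.coe_range, Set.mem_Iio]
  by_contra hN
  exact hm (by simp [sliceTerm, iterate_eq_zero_of_le h (not_lt.1 hN)])

lemma iterate_add_apply' (d : Derivation k R R) (a b : R) (m : ℕ) :
    d^[m] (a + b) = d^[m] a + d^[m] b := iterate_map_add d m a b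

variable {d : Derivation k R R} {f : R}

lemma sliceProj_of_apply_eq_zero {a : R} (h : d a = 0) : sliceProj d f a = a := by
  rw [sliceProj_eq (N := 1) (by simpa using h)]
  simp [sliceTerm]

lemma inv_factorial_succ_mul (m : ℕ) :
    (((m + 1).factorial : k)⁻¹) * ((m : k) + 1) = (m.factorial : k)⁻¹ := by
  have h : ((m : k) + 1) ≠ 0 := by exact_mod_cast m.succ_ne_zero
  rw [Nat.factorial_succ]
  push_cast
  field_simp

/-- The sum telescopes: differentiating `(-f) ^ m` cancels the contribution of the preceding term,
so only the last one survives. -/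
lemma apply_sum_sliceTerm (hf : d f = 1) (a : R) (N : ℕ) :
    d (∑ m ∈ Finset.range (N + 1), sliceTerm d f a m) =
      ((N.factorial : k)⁻¹) • ((-f) ^ N * d^[N + 1] a) := by
  induction N with
  | zero => simp [sliceTerm]
  | succ N ih =>
    rw [Finset.sum_range_succ, map_add, ih, sliceTerm, d.map_smul, Derivation.leibniz,
      Derivation.leibniz_pow, map_neg, hf, ← Function.iterate_succ_apply' d,
      ← inv_factorial_succ_mul N, mul_smul]
    rw [smul_eq_mul, smul_eq_mul, nsmul_eq_mul, smul_eq_mul, Nat.add_sub_cancel]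
    simp only [Algebra.smul_def, map_add, map_one, map_natCast, Nat.cast_add, Nat.cast_one]
    ring

lemma apply_sliceProj (hf : d f = 1) {a : R} (ha : ∃ N, d^[N] a = 0) :
    d (sliceProj d f a) = 0 := by
  obtain ⟨N, hN⟩ := ha
  have hN1 := iterate_eq_zero_of_le hN N.le_succ
  rw [sliceProj_eq hN1, apply_sum_sliceTerm hf, hN1, mul_zero, smul_zero]

lemma sliceProj_add {a b : R} (ha : ∃ N, d^[N] a = 0) (hb : ∃ N, d^[N] b = 0) :
    sliceProj d f (a + b) = sliceProj d f a + sliceProj d f b := by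
  obtain ⟨N, hN⟩ := ha
  obtain ⟨N', hN'⟩ := hb
  have h1 := iterate_eq_zero_of_le hN (le_max_left N N')
  have h2 := iterate_eq_zero_of_le hN' (le_max_right N N')
  have h3 : d^[max N N'] (a + b) = 0 := by rw [iterate_add_apply', h1, h2, add_zero]
  rw [sliceProj_eq h1, sliceProj_eq h2, sliceProj_eq h3, ← Finset.sum_add_distrib]
  refine Finset.sum_congr rfl fun m _ => ?_
  rw [sliceTerm, sliceTerm, sliceTerm, iterate_add_apply', mul_add, smul_add]

lemma iterate_mul_slice (hf : d f = 1) (b : R) (m : ℕ) :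
    d^[m + 1] (f * b) = f * d^[m + 1] b + ((m : R) + 1) * d^[m] b := by
  induction m with
  | zero => simp [hf, add_comm]
  | succ m ih =>
    rw [Function.iterate_succ_apply', ih, map_add, Derivation.leibniz, Derivation.leibniz, hf,
      ← Function.iterate_succ_apply' d, ← Function.iterate_succ_apply' d, map_add,
      Derivation.map_natCast, Derivation.map_one_eq_zero]
    simp only [smul_eq_mul, Nat.cast_add, Nat.cast_one]
    ring

lemma sum_sliceTerm_mul (hf : d f = 1) (b : R) (N : ℕ) :
    ∑ m ∈ Finset.range (N + 1), sliceTerm d f (f * b) m =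
      ((N.factorial : k)⁻¹) • ((-f) ^ N * (f * d^[N] b)) := by
  induction N with
  | zero => simp [sliceTerm]
  | succ N ih =>
    rw [Finset.sum_range_succ, ih, sliceTerm, iterate_mul_slice hf, ← inv_factorial_succ_mul N]
    simp only [Algebra.smul_def, map_add, map_one, map_natCast, map_mul]
    ring

lemma sliceProj_mul_slice (hf : d f = 1) {b : R} (hb : ∃ N, d^[N] b = 0) :
    sliceProj d f (f * b) = 0 := by
  obtain ⟨N, hN⟩ := hb
  have h : d^[N + 1] (f * b) = 0 := by
    rw [iterate_mul_slice hf, hN, iterate_eq_zero_of_le hN N.le_succ, mul_zero, mul_zero, add_zero]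
  rw [sliceProj_eq h, sum_sliceTerm_mul hf, hN, mul_zero, mul_zero, smul_zero]

lemma exists_sliceProj_eq_add {a : R} (ha : ∃ N, d^[N] a = 0) :
    ∃ b, sliceProj d f a = a + f * b := by
  obtain ⟨N, hN⟩ := ha
  rw [sliceProj_eq (iterate_eq_zero_of_le hN N.le_succ), Finset.sum_range_succ']
  refine ⟨∑ m ∈ Finset.range N, -(((m + 1).factorial : k)⁻¹ • ((-f) ^ m * d^[m + 1] a)), ?_⟩
  rw [Finset.mul_sum, add_comm]
  congr 1
  · simp [sliceTerm]
  · refine Finset.sum_congr rfl fun m _ => ?_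
    rw [sliceTerm, pow_succ]
    simp only [Algebra.smul_def]
    ring

/-- Modulo `f` the projection is the identity, so `a * b` differs from the product of the
projections by a multiple of `f`. The projection kills multiples of `f` and fixes constants, and the
product of the projections is a constant. -/
lemma sliceProj_mul (hf : d f = 1) (hd : ∀ a, ∃ N, d^[N] a = 0) (a b : R) :
    sliceProj d f (a * b) = sliceProj d f a * sliceProj d f b := by
  obtain ⟨a', ha'⟩ := exists_sliceProj_eq_add (f := f) (hd a)
  obtain ⟨b', hb'⟩ := exists_sliceProj_eq_add (f := f) (hd b)
  have h : d (sliceProj d f a * sliceProj d f b) = 0 := by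
    rw [Derivation.leibniz, apply_sliceProj hf (hd a), apply_sliceProj hf (hd b), smul_zero,
      smul_zero, add_zero]
  have h2 : a * b = sliceProj d f a * sliceProj d f b +
      f * (-(a' * sliceProj d f b) - b' * a) := by
    rw [ha', hb']; ring
  rw [h2, sliceProj_add (hd _) (hd _), sliceProj_mul_slice hf (hd _), add_zero,
    sliceProj_of_apply_eq_zero h]

/-- The projection to the constants as a homomorphism of algebras. -/
noncomputable def sliceHom (hf : d f = 1) (hd : ∀ a, ∃ N, d^[N] a = 0) : R →ₐ[k] R where
  toFun := sliceProj d f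
  map_one' := sliceProj_of_apply_eq_zero d.map_one_eq_zero
  map_mul' := sliceProj_mul hf hd
  map_zero' := sliceProj_of_apply_eq_zero d.map_zero
  map_add' a b := sliceProj_add (hd a) (hd b)
  commutes' c := sliceProj_of_apply_eq_zero (d.map_algebraMap c)

lemma apply_iterate_eq_zero {d' : Derivation k R R} (hc : ∀ a, d' (d a) = d (d' a)) {a : R}
    (ha : d' a = 0) (m : ℕ) : d' (d^[m] a) = 0 := by
  have : Function.Commute (⇑d') (⇑d) := hc
  rw [(this.iterate_right m).eq, ha]
  exact Function.iterate_fixed d.map_zero m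

lemma apply_sliceProj_of_commute {d' : Derivation k R R} (hc : ∀ a, d' (d a) = d (d' a))
    (hf : d' f = 0) {a : R} (hN : ∃ N, d^[N] a = 0) (ha : d' a = 0) :
    d' (sliceProj d f a) = 0 := by
  obtain ⟨N, hN⟩ := hN
  rw [sliceProj_eq hN, map_sum]
  refine Finset.sum_eq_zero fun m _ => ?_
  rw [sliceTerm, d'.map_smul, Derivation.leibniz, Derivation.leibniz_pow, map_neg, hf,
    apply_iterate_eq_zero hc ha]
  simp

end Slice

/-! ### Commuting families of derivations with slices -/

section Slices

variable {k R I : Type*} [Field k] [CharZero k] [CommRing R] [Algebra k R]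
  {d : I → Derivation k R R} {f : I → R}

/-- The projections along the single slices are composed. The one for `j` preserves the constants of
the other `d i`, because these commute with `d j` and kill `f j`. -/
lemma exists_retraction_constants_finset [DecidableEq I]
    (hc : ∀ i j a, d i (d j a) = d j (d i a))
    (hf : ∀ i j, d i (f j) = if i = j then 1 else 0) (hd : ∀ i a, ∃ N, (d i)^[N] a = 0)
    (s : Finset I) :
    ∃ r : R →ₐ[k] R, (∀ i ∈ s, ∀ a, d i (r a) = 0) ∧ ∀ a, (∀ i, d i a = 0) → r a = a := by
  induction s using Finset.induction_on with
  | empty => exact ⟨AlgHom.id k R, by simp, fun a _ => rfl⟩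
  | insert j s hj ih =>
    obtain ⟨r, hr, hr'⟩ := ih
    have hfj : d j (f j) = 1 := by simp [hf]
    refine ⟨(sliceHom hfj (hd j)).comp r, fun i hi a => ?_, fun a ha => ?_⟩
    · change d i (sliceProj (d j) (f j) (r a)) = 0
      by_cases hij : i = j
      · subst hij
        exact apply_sliceProj hfj (hd i _)
      · refine apply_sliceProj_of_commute (hc i j) (by simp [hf, hij]) (hd j _) ?_
        exact hr i ((Finset.mem_insert.1 hi).resolve_left hij) a
    · change sliceProj (d j) (f j) (r a) = a
      rw [hr' a ha]
      exact sliceProj_of_apply_eq_zero (ha j)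

/-- Commuting locally nilpotent derivations with slices admit a retraction to the constants. -/
lemma exists_retraction_constants [Fintype I] [DecidableEq I]
    (hc : ∀ i j a, d i (d j a) = d j (d i a))
    (hf : ∀ i j, d i (f j) = if i = j then 1 else 0) (hd : ∀ i a, ∃ N, (d i)^[N] a = 0) :
    ∃ r : R →ₐ[k] R, (∀ i a, d i (r a) = 0) ∧ ∀ a, (∀ i, d i a = 0) → r a = a := by
  obtain ⟨r, hr, hr'⟩ := exists_retraction_constants_finset hc hf hd Finset.univ
  exact ⟨r, fun i => hr i (Finset.mem_univ i), hr'⟩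

/-- Double induction: on the set of derivations that need not kill `a`, and on the nilpotency order
of `d j` at `a`. The projection of `a` along `f j` is killed by one more derivation, and it differs
from `a` by terms in `f j` and in the iterates `d j^[m + 1] a`, whose nilpotency order is smaller.
-/
lemma mem_of_slices_mem [Fintype I] [DecidableEq I]
    (hc : ∀ i j a, d i (d j a) = d j (d i a))
    (hf : ∀ i j, d i (f j) = if i = j then 1 else 0) (hd : ∀ i a, ∃ N, (d i)^[N] a = 0)
    (S : Subalgebra k R) (hS : ∀ a, (∀ i, d i a = 0) → a ∈ S) (hfS : ∀ i, f i ∈ S) (a : R) :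
    a ∈ S := by
  suffices H : ∀ (s : Finset I) (a : R), (∀ i, i ∉ s → d i a = 0) → a ∈ S from
    H Finset.univ a fun i hi => absurd (Finset.mem_univ i) hi
  intro s
  induction s using Finset.induction_on with
  | empty => exact fun a ha => hS a fun i => ha i (Finset.notMem_empty i)
  | insert j s hj ih =>
    have hfj : d j (f j) = 1 := by simp [hf]
    suffices H : ∀ (N : ℕ) (a : R), (d j)^[N] a = 0 → (∀ i, i ∉ insert j s → d i a = 0) → a ∈ S by
      intro a ha
      obtain ⟨N, hN⟩ := hd j a
      exact H N a hN ha
    intro N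
    induction N with
    | zero => intro a ha _; rw [show a = 0 from ha]; exact S.zero_mem
    | succ N ihN =>
      intro a ha hi
      have hmem : ∀ m, (d j)^[m + 1] a ∈ S := fun m => by
        refine ihN _ ?_ fun i his => ?_
        · rw [← Function.iterate_add_apply]
          exact iterate_eq_zero_of_le ha (by omega)
        · exact apply_iterate_eq_zero (hc i j) (hi i his) _
      have hP : sliceProj (d j) (f j) a ∈ S := by
        refine ih _ fun i his => ?_
        by_cases hij : i = j
        · subst hij
          exact apply_sliceProj hfj (hd i a)
        · exact apply_sliceProj_of_commute (hc i j) (by simp [hf, hij]) (hd j a)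
            (hi i (by simp [hij, his]))
      rw [sliceProj_eq ha, Finset.sum_range_succ'] at hP
      have h0 : sliceTerm (d j) (f j) a 0 = a := by simp [sliceTerm]
      rw [h0] at hP
      refine (add_mem_cancel_left (S.sum_mem fun m _ => ?_)).1 hP
      exact S.smul_mem (S.mul_mem (S.pow_mem (S.neg_mem (hfS j)) _) (hmem m)) _

/-- From a nonzero element of `S`, applying each derivation as long as the result is nonzero would
lead to a nonzero constant in `S`. The lemma serves to prove injectivity, with `S` the kernel of an
equivariant homomorphism. -/
lemma eq_zero_of_constants [Fintype I] [DecidableEq I]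
    (hc : ∀ i j a, d i (d j a) = d j (d i a)) (hd : ∀ i a, ∃ N, (d i)^[N] a = 0)
    {S : Set R} (hS : ∀ i, ∀ a ∈ S, d i a ∈ S) (hS0 : ∀ a ∈ S, (∀ i, d i a = 0) → a = 0)
    {a : R} (ha : a ∈ S) : a = 0 := by
  suffices H : ∀ (s : Finset I) (a : R), a ∈ S → (∀ i, i ∉ s → d i a = 0) → a = 0 from
    H Finset.univ a ha fun i hi => absurd (Finset.mem_univ i) hi
  clear ha a
  intro s
  induction s using Finset.induction_on with
  | empty => exact fun a ha h => hS0 a ha fun i => h i (Finset.notMem_empty i)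
  | insert j s hj ih =>
    suffices H : ∀ (N : ℕ) (a : R), (d j)^[N] a = 0 → a ∈ S →
        (∀ i, i ∉ insert j s → d i a = 0) → a = 0 by
      intro a ha h
      obtain ⟨N, hN⟩ := hd j a
      exact H N a hN ha h
    intro N
    induction N with
    | zero => exact fun a ha _ _ => ha
    | succ N ihN =>
      intro a hN ha h
      have hja : d j a = 0 := ihN _ hN (hS j a ha) fun i hi => by rw [hc, h i hi, map_zero]
      refine ih a ha fun i hi => ?_
      by_cases hij : i = j
      · rw [hij, hja]
      · exact h i (by simp [hij, hi])

lemma iterate_mul_eq_zero {e : Derivation k R R} {a b : R} (ha : ∃ N, e^[N] a = 0)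
    (hb : ∃ N, e^[N] b = 0) : ∃ N, e^[N] (a * b) = 0 := by
  suffices H : ∀ (n N N' : ℕ) (a b : R), N + N' ≤ n → e^[N] a = 0 → e^[N'] b = 0 →
      e^[n] (a * b) = 0 by
    obtain ⟨N, hN⟩ := ha
    obtain ⟨N', hN'⟩ := hb
    exact ⟨N + N', H _ N N' a b le_rfl hN hN'⟩
  intro n
  induction n with
  | zero =>
    intro N N' a b h ha _
    obtain rfl : N = 0 := by omega
    simp [show a = 0 from ha]
  | succ n ih =>
    intro N N' a b h ha hb
    have hz : ∀ m, e^[m] 0 = 0 := fun m => Function.iterate_fixed e.map_zero m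
    cases N with
    | zero => rw [show a = 0 from ha, zero_mul, hz]
    | succ N =>
      cases N' with
      | zero => rw [show b = 0 from hb, mul_zero, hz]
      | succ N' =>
        rw [Function.iterate_succ_apply, Derivation.leibniz, smul_eq_mul, smul_eq_mul,
          iterate_add_apply', ih (N + 1) N' a (e b) (by omega) ha hb,
          ih (N' + 1) N b (e a) (by omega) hb ha, add_zero]

variable (k) in
/-- The subalgebra on which a derivation is locally nilpotent. -/
def nilSubalgebra (e : Derivation k R R) : Subalgebra k R where
  carrier := {a | ∃ N, e^[N] a = 0}
  mul_mem' := iterate_mul_eq_zero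
  add_mem' := by
    rintro a b ⟨N, hN⟩ ⟨N', hN'⟩
    refine ⟨max N N', ?_⟩
    rw [iterate_add_apply', iterate_eq_zero_of_le hN (le_max_left _ _),
      iterate_eq_zero_of_le hN' (le_max_right _ _), add_zero]
  algebraMap_mem' c := ⟨1, e.map_algebraMap c⟩

lemma mem_nilSubalgebra_of_apply_mem {e : Derivation k R R} {a : R} (h : e a ∈ nilSubalgebra k e) :
    a ∈ nilSubalgebra k e := by
  obtain ⟨N, hN⟩ := h
  exact ⟨N + 1, hN⟩

end Slices

/-! ### Coactions and the derivations given by point derivations -/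

section Coaction

open TensorProduct

variable {k H A V W : Type*} [Field k] [CommRing H] [Algebra k H] [CommRing A] [Algebra k A]
  [AddCommGroup V] [Module k V] [AddCommGroup W] [Module k W]

/-- Contraction of the first tensor factor with a linear functional. -/
noncomputable def contract (p : H →ₗ[k] k) (V : Type*) [AddCommGroup V] [Module k V] :
    TensorProduct k H V →ₗ[k] V :=
  (TensorProduct.lid k V).toLinearMap ∘ₗ p.rTensor V

@[simp]
lemma contract_tmul (p : H →ₗ[k] k) (h : H) (v : V) : contract p V (h ⊗ₜ[k] v) = p h • v := by
  simp [contract]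

lemma contract_lTensor (p : H →ₗ[k] k) (g : V →ₗ[k] W) (x : H ⊗[k] V) :
    contract p W (g.lTensor H x) = g (contract p V x) := by
  induction x with
  | zero => simp
  | tmul h v => simp
  | add x y hx hy => simp only [map_add, hx, hy]

lemma contract_rTensor (p : H →ₗ[k] k) (g : H →ₗ[k] H) (x : H ⊗[k] V) :
    contract p V (g.rTensor V x) = contract (p ∘ₗ g) V x := by
  induction x with
  | zero => simp
  | tmul h v => simp
  | add x y hx hy => simp only [map_add, hx, hy]

lemma contract_assoc (p : H →ₗ[k] k) (x : (H ⊗[k] H) ⊗[k] V) :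
    contract p (H ⊗[k] V) (TensorProduct.assoc k H H V x) = (contract p H).rTensor V x := by
  induction x with
  | zero => simp
  | tmul y v =>
    induction y with
    | zero => simp
    | tmul h h' => simp [TensorProduct.smul_tmul']
    | add y z hy hz => simp only [add_tmul, map_add, hy, hz]
  | add x y hx hy => simp only [map_add, hx, hy]

lemma contract_add (p q : H →ₗ[k] k) (x : H ⊗[k] V) :
    contract (p + q) V x = contract p V x + contract q V x := by
  simp [contract, LinearMap.rTensor_add]

lemma contract_smul (c : k) (p : H →ₗ[k] k) (x : H ⊗[k] V) :
    contract (c • p) V x = c • contract p V x := by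
  simp [contract, LinearMap.rTensor_smul]

lemma contract_zero (x : H ⊗[k] V) : contract 0 V x = 0 := by
  simp [contract]

lemma contract_sum {J : Type*} (s : Finset J) (c : J → k) (p : J → H →ₗ[k] k) (x : H ⊗[k] V) :
    contract (∑ j ∈ s, c j • p j) V x = ∑ j ∈ s, c j • contract (p j) V x := by
  classical
  induction s using Finset.induction_on with
  | empty => simp [contract_zero]
  | insert j s hj ih => rw [Finset.sum_insert hj, Finset.sum_insert hj, contract_add,
      contract_smul, ih]

variable (ct : H →ₐ[k] k) (cm : H →ₐ[k] H ⊗[k] H)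

/-- The space of point derivations of `H` at the point `ct`. -/
def pointDer : Submodule k (H →ₗ[k] k) where
  carrier := {p | ∀ g h, p (g * h) = ct g * p h + ct h * p g}
  add_mem' := by
    intro p q hp hq g h
    rw [LinearMap.add_apply, LinearMap.add_apply, LinearMap.add_apply, hp, hq]
    ring
  zero_mem' := by intro g h; simp
  smul_mem' := by
    intro c p hp g h
    rw [LinearMap.smul_apply, LinearMap.smul_apply, LinearMap.smul_apply, hp]
    simp only [smul_eq_mul]
    ring

variable {ct} in
lemma pointDer_one {p : H →ₗ[k] k} (hp : p ∈ pointDer ct) : p 1 = 0 := by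
  have := hp 1 1
  simpa using this

/-- `co` is a left coaction with respect to the comultiplication `cm` and the counit `ct`. -/
structure IsCoaction (co : A →ₐ[k] H ⊗[k] A) : Prop where
  coassoc : ∀ a, TensorProduct.assoc k H H A (cm.toLinearMap.rTensor A (co a)) =
    co.toLinearMap.lTensor H (co a)
  counit : ∀ a, contract ct.toLinearMap A (co a) = a

variable {ct cm} {co : A →ₐ[k] H ⊗[k] A}

lemma contract_mul {p : H →ₗ[k] k} (hp : p ∈ pointDer ct) (x y : H ⊗[k] A) :
    contract p A (x * y) = contract ct.toLinearMap A x * contract p A y +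
      contract ct.toLinearMap A y * contract p A x := by
  induction x with
  | zero => simp
  | add x x' hx hx' => simp only [add_mul, mul_add, map_add, hx, hx']; ring
  | tmul h a =>
    induction y with
    | zero => simp
    | add y y' hy hy' => simp only [mul_add, add_mul, map_add, hy, hy']; ring
    | tmul h' a' =>
      simp only [Algebra.TensorProduct.tmul_mul_tmul, contract_tmul, AlgHom.toLinearMap_apply,
        hp h h', Algebra.smul_def, map_add, map_mul]
      ring

/-- The derivation of `A` given by a point derivation through the coaction. -/
noncomputable def coDer (hco : IsCoaction ct cm co) (p : pointDer ct) : Derivation k A A :=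
  Derivation.mk' (contract p.1 A ∘ₗ co.toLinearMap) fun a b => by
    simp only [LinearMap.comp_apply, AlgHom.toLinearMap_apply, map_mul, smul_eq_mul]
    rw [contract_mul p.2, hco.counit, hco.counit]

lemma coDer_apply (hco : IsCoaction ct cm co) (p : pointDer ct) (a : A) :
    coDer hco p a = contract p.1 A (co a) := rfl

/-- The action of a linear functional on `H` through the comultiplication. -/
noncomputable def leftInv (cm : H →ₐ[k] H ⊗[k] H) (p : H →ₗ[k] k) : H →ₗ[k] H :=
  contract p H ∘ₗ cm.toLinearMap

/-- Coassociativity contracted with `p`: the coaction intertwines the operator that `p` defines on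
`A` with the one that it defines on `H`. Facts about functions on the group thereby pass to `A`. -/
lemma leftInv_rTensor_coaction (hco : IsCoaction ct cm co) (p : H →ₗ[k] k) (a : A) :
    (leftInv cm p).rTensor A (co a) = co (contract p A (co a)) := by
  rw [leftInv, LinearMap.rTensor_comp_apply, ← contract_assoc, hco.coassoc, contract_lTensor]
  rfl

/-- The point derivation given by the commutator of two point derivations. -/
noncomputable def pointBracket (hcm : IsCoaction ct cm cm) (p q : pointDer ct) : pointDer ct :=
  ⟨ct.toLinearMap ∘ₗ (⁅coDer hcm p, coDer hcm q⁆ : Derivation k H H).toLinearMap, fun g h => by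
    change ct ((⁅coDer hcm p, coDer hcm q⁆ : Derivation k H H) (g * h)) =
      ct g * ct ((⁅coDer hcm p, coDer hcm q⁆ : Derivation k H H) h) +
      ct h * ct ((⁅coDer hcm p, coDer hcm q⁆ : Derivation k H H) g)
    rw [(⁅coDer hcm p, coDer hcm q⁆ : Derivation k H H).leibniz, smul_eq_mul, smul_eq_mul,
      map_add, map_mul, map_mul]⟩

/-- The commutator is formed on `H`, where it is evaluated at the identity to define `pointBracket`.
The intertwining relation carries it through the coaction, and the counit law removes the factor
`H`. -/
lemma coDer_pointBracket (hcm : IsCoaction ct cm cm) (hco : IsCoaction ct cm co)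
    (p q : pointDer ct) (a : A) :
    coDer hco (pointBracket hcm p q) a =
      coDer hco p (coDer hco q a) - coDer hco q (coDer hco p a) := by
  refine (contract_rTensor ct.toLinearMap
    (⁅coDer hcm p, coDer hcm q⁆ : Derivation k H H).toLinearMap (co a)).symm.trans ?_
  have h1 : (⁅coDer hcm p, coDer hcm q⁆ : Derivation k H H).toLinearMap =
      leftInv cm p.1 ∘ₗ leftInv cm q.1 - leftInv cm q.1 ∘ₗ leftInv cm p.1 := by
    ext h
    exact Derivation.commutator_apply (D1 := coDer hcm p) (D2 := coDer hcm q) (a := h)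
  rw [h1, LinearMap.rTensor_sub, LinearMap.sub_apply, LinearMap.rTensor_comp_apply,
    LinearMap.rTensor_comp_apply, leftInv_rTensor_coaction hco, leftInv_rTensor_coaction hco,
    leftInv_rTensor_coaction hco, leftInv_rTensor_coaction hco, map_sub, hco.counit, hco.counit]
  rfl

end Coaction

/-! ### Dual vectors and vanishing of polynomials -/

section LinearAlgebra

variable {k V J : Type*} [Field k] [AddCommGroup V] [Module k V]

/-- The functionals together map onto `J → k`: a nonzero functional vanishing on the image would be
a linear relation between them. -/
lemma exists_dual_vectors [Fintype J] [DecidableEq J] {p : J → V →ₗ[k] k}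
    (hp : LinearIndependent k p) :
    ∃ x : J → V, ∀ i j, p i (x j) = if i = j then 1 else 0 := by
  have hs : Function.Surjective (LinearMap.pi p) := by
    rw [← LinearMap.range_eq_top]
    by_contra h
    obtain ⟨g, hg, hle⟩ := Submodule.exists_le_ker_of_lt_top _ (lt_top_iff_ne_top.2 h)
    apply hg
    have hsum : ∑ i, g (Pi.single i 1) • p i = 0 := by
      ext v
      have h1 : g (LinearMap.pi p v) = 0 := hle ⟨v, rfl⟩
      rw [← Finset.univ_sum_single (LinearMap.pi p v), map_sum] at h1
      rw [LinearMap.sum_apply, LinearMap.zero_apply, ← h1]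
      refine Finset.sum_congr rfl fun i _ => ?_
      rw [LinearMap.smul_apply, LinearMap.pi_apply, smul_eq_mul, mul_comm, ← smul_eq_mul,
        ← map_smul, ← Pi.single_smul, smul_eq_mul, mul_one]
    have h0 := Fintype.linearIndependent_iff.1 hp _ hsum
    refine LinearMap.pi_ext fun i c => ?_
    rw [← mul_one c, ← smul_eq_mul, Pi.single_smul, map_smul, h0 i]
    simp
  choose x hx using fun j => hs (Pi.single j 1)
  refine ⟨x, fun i j => ?_⟩
  have := congrFun (hx j) i
  rw [LinearMap.pi_apply] at this
  rw [this, Pi.single_apply]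

/-- The ring `R` may have zero divisors, so roots are not counted in `R`; every linear functional `R
→ k` turns `p` into a polynomial over the field `k` with infinitely many roots. -/
lemma polynomial_eq_zero_of_eval {R : Type*} [CommRing R] [Algebra k R] {p : Polynomial R}
    {S : Set k} (hS : S.Infinite) (h : ∀ t ∈ S, p.eval (algebraMap k R t) = 0) : p = 0 := by
  ext n
  rw [Polynomial.coeff_zero, ← Module.forall_dual_apply_eq_zero_iff k]
  intro g
  let q : Polynomial k := ∑ m ∈ p.support, Polynomial.monomial m (g (p.coeff m))
  have hq : q = 0 := by
    refine Polynomial.eq_zero_of_infinite_isRoot q (hS.mono fun t ht => ?_)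
    change q.eval t = 0
    have := congrArg g (h t ht)
    rw [map_zero, Polynomial.eval_eq_sum, Polynomial.sum, map_sum] at this
    rw [Polynomial.eval_finsetSum, ← this]
    refine Finset.sum_congr rfl fun m _ => ?_
    rw [Polynomial.eval_monomial, ← map_pow, mul_comm, mul_comm (p.coeff m), ← Algebra.smul_def,
      map_smul, smul_eq_mul]
  have hc := congrArg (fun r => Polynomial.coeff r n) hq
  simp only [q, Polynomial.finsetSum_coeff, Polynomial.coeff_monomial, Finset.sum_ite_eq',
    Polynomial.coeff_zero] at hc
  by_cases hn : n ∈ p.support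
  · simpa [hn] using hc
  · rw [Polynomial.notMem_support_iff.1 hn, map_zero]

end LinearAlgebra

/-! ### Unipotent Hopf algebras -/

section Unipotent

open TensorProduct

variable {k H : Type*} [Field k] [CommRing H] [Algebra k H]

variable (k) in
/-- A matrix of generators of `H` exhibiting its spectrum as a closed submonoid of the monoid of
upper triangular matrices with diagonal entries `1`. -/
structure IsUnitriangular (ct : H →ₐ[k] k) (cm : H →ₐ[k] H ⊗[k] H) {n : ℕ}
    (M : Matrix (Fin n) (Fin n) H) : Prop where
  diag : ∀ i, M i i = 1
  lower : ∀ i j, j < i → M i j = 0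
  comul : ∀ i j, cm (M i j) = ∑ l, M i l ⊗ₜ[k] M l j
  counit : ∀ i j, ct (M i j) = if i = j then 1 else 0
  adjoin : Algebra.adjoin k (Set.range fun p : Fin n × Fin n => M p.1 p.2) = ⊤

variable {ct : H →ₐ[k] k} {cm : H →ₐ[k] H ⊗[k] H} {n : ℕ} {M : Matrix (Fin n) (Fin n) H}

variable (ct cm) in
/-- The pullback of functions under the `m`-th power map. -/
noncomputable def powHom : ℕ → H →ₐ[k] H
  | 0 => (Algebra.ofId k H).comp ct
  | m + 1 => (Algebra.TensorProduct.productMap (AlgHom.id k H) (powHom m)).comp cm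

lemma powHom_matrix (hM : IsUnitriangular k ct cm M) (m : ℕ) (i j : Fin n) :
    powHom ct cm m (M i j) = (M ^ m) i j := by
  induction m generalizing i j with
  | zero =>
    rw [pow_zero, Matrix.one_apply]
    change Algebra.ofId k H (ct (M i j)) = _
    rw [hM.counit]
    split_ifs <;> simp
  | succ m ih =>
    change Algebra.TensorProduct.productMap (AlgHom.id k H) (powHom ct cm m) (cm (M i j)) = _
    rw [hM.comul, map_sum, pow_succ', Matrix.mul_apply]
    refine Finset.sum_congr rfl fun l _ => ?_
    rw [Algebra.TensorProduct.productMap_apply_tmul, ih]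
    rfl

lemma powHom_one (hct : ∀ h, TensorProduct.rid k H (ct.toLinearMap.lTensor H (cm h)) = h) (h : H) :
    powHom ct cm 1 h = h := by
  change Algebra.TensorProduct.productMap (AlgHom.id k H) (powHom ct cm 0) (cm h) = h
  conv_rhs => rw [← hct h]
  induction cm h with
  | zero => simp
  | tmul g g' =>
    simp only [Algebra.TensorProduct.productMap_apply_tmul, LinearMap.lTensor_tmul,
      TensorProduct.rid_tmul, Algebra.smul_def]
    rw [mul_comm]
    rfl
  | add x y hx hy => simp only [map_add, hx, hy]

lemma pow_sub_one_apply_eq_zero (hM : IsUnitriangular k ct cm M) (l : ℕ) {i j : Fin n}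
    (hij : (j : ℕ) < i + l) : ((M - 1) ^ l) i j = 0 := by
  induction l generalizing i j with
  | zero =>
    rw [pow_zero, Matrix.one_apply_ne]
    rintro rfl
    omega
  | succ l ih =>
    rw [pow_succ', Matrix.mul_apply]
    refine Finset.sum_eq_zero fun m _ => ?_
    by_cases hm : (j : ℕ) < m + l
    · rw [ih hm, mul_zero]
    · have hmi : m ≤ i := by rw [Fin.le_def]; omega
      have h0 : (M - 1) i m = 0 := by
        rw [Matrix.sub_apply]
        rcases hmi.lt_or_eq with h | rfl
        · rw [hM.lower i m h, Matrix.one_apply_ne h.ne', sub_zero]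
        · rw [hM.diag, Matrix.one_apply_eq, sub_self]
      rw [h0, zero_mul]

lemma pow_sub_one_eq_zero (hM : IsUnitriangular k ct cm M) {l : ℕ} (hl : n ≤ l) :
    (M - 1) ^ l = 0 := by
  ext i j
  exact pow_sub_one_apply_eq_zero hM l (by omega)

/-- As `M - 1` is nilpotent, the binomial expansion has a number of terms independent of `m`. The
entries of `M ^ m` are therefore polynomial in `m`. -/
lemma matrix_pow_eq_sum (hM : IsUnitriangular k ct cm M) (m : ℕ) :
    M ^ m = ∑ l ∈ Finset.range n, (m.choose l) • (M - 1) ^ l := by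
  have h : M ^ m = ∑ l ∈ Finset.range (m + 1), (m.choose l) • (M - 1) ^ l := by
    conv_lhs => rw [← sub_add_cancel M 1]
    rw [(Commute.one_right (M - 1)).add_pow]
    refine Finset.sum_congr rfl fun l _ => ?_
    rw [one_pow, mul_one, nsmul_eq_mul, ← (Nat.cast_commute _ _).eq]
  have h1 : ∑ l ∈ Finset.range (m + 1), (m.choose l) • (M - 1) ^ l =
      ∑ l ∈ Finset.range (m + 1 + n), (m.choose l) • (M - 1) ^ l := by
    refine Finset.sum_subset (Finset.range_mono (by omega)) fun l _ hl => ?_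
    rw [Nat.choose_eq_zero_of_lt (by simpa using hl), zero_smul]
  have h2 : ∑ l ∈ Finset.range n, (m.choose l) • (M - 1) ^ l =
      ∑ l ∈ Finset.range (m + 1 + n), (m.choose l) • (M - 1) ^ l := by
    refine Finset.sum_subset (Finset.range_mono (by omega)) fun l _ hl => ?_
    rw [pow_sub_one_eq_zero hM (by simpa using hl), smul_zero]
  rw [h, h1, h2]

variable [CharZero k]

variable (k H) in
/-- The polynomial whose value at a natural number `m` is the binomial coefficient `m.choose l`. -/
noncomputable def choosePoly (l : ℕ) : Polynomial H :=
  ((l.factorial : k)⁻¹) • descPochhammer H l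

lemma choosePoly_eval (l m : ℕ) : (choosePoly k H l).eval (m : H) = m.choose l := by
  have h : (l.factorial : k) ≠ 0 := by exact_mod_cast l.factorial_ne_zero
  rw [choosePoly, Polynomial.eval_smul, descPochhammer_eval_eq_descFactorial,
    Nat.descFactorial_eq_factorial_mul_choose, Nat.cast_mul, Algebra.smul_def, ← mul_assoc,
    ← map_natCast (algebraMap k H) l.factorial, ← map_mul, inv_mul_cancel₀ h, map_one, one_mul]

variable (ct cm) in
/-- The polynomial `p` interpolates the pullbacks of `h` under the power maps. -/
def Interpolates (h : H) (p : Polynomial H) : Prop :=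
  ∀ m : ℕ, powHom ct cm m h = p.eval (m : H)

lemma Interpolates.mul {g h : H} {p q : Polynomial H} (hp : Interpolates ct cm g p)
    (hq : Interpolates ct cm h q) : Interpolates ct cm (g * h) (p * q) := fun m => by
  rw [map_mul, Polynomial.eval_mul, hp, hq]

lemma Interpolates.add {g h : H} {p q : Polynomial H} (hp : Interpolates ct cm g p)
    (hq : Interpolates ct cm h q) : Interpolates ct cm (g + h) (p + q) := fun m => by
  rw [map_add, Polynomial.eval_add, hp, hq]

lemma exists_interpolates (hM : IsUnitriangular k ct cm M) (h : H) :
    ∃ p, Interpolates ct cm h p := by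
  have hh : h ∈ Algebra.adjoin k (Set.range fun p : Fin n × Fin n => M p.1 p.2) := by
    rw [hM.adjoin]; trivial
  induction hh using Algebra.adjoin_induction with
  | mem x hx =>
    obtain ⟨⟨i, j⟩, rfl⟩ := hx
    refine ⟨∑ l ∈ Finset.range n, choosePoly k H l * Polynomial.C (((M - 1) ^ l) i j),
      fun m => ?_⟩
    rw [powHom_matrix hM, matrix_pow_eq_sum hM, Polynomial.eval_finsetSum, Matrix.sum_apply]
    refine Finset.sum_congr rfl fun l _ => ?_
    rw [Polynomial.eval_mul, choosePoly_eval, Polynomial.eval_C, Matrix.smul_apply, nsmul_eq_mul]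
  | algebraMap c =>
    exact ⟨Polynomial.C (algebraMap k H c), fun m => by rw [Polynomial.eval_C, AlgHom.commutes]⟩
  | add x y _ _ hx hy =>
    obtain ⟨p, hp⟩ := hx
    obtain ⟨q, hq⟩ := hy
    exact ⟨p + q, hp.add hq⟩
  | mul x y _ _ hx hy =>
    obtain ⟨p, hp⟩ := hx
    obtain ⟨q, hq⟩ := hy
    exact ⟨p * q, hp.mul hq⟩

lemma Interpolates.unique {h : H} {p q : Polynomial H} (hp : Interpolates ct cm h p)
    (hq : Interpolates ct cm h q) : p = q := by
  rw [← sub_eq_zero]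
  refine polynomial_eq_zero_of_eval (k := k) (S := Set.range ((↑) : ℕ → k))
    (Set.infinite_range_of_injective Nat.cast_injective) ?_
  rintro _ ⟨m, rfl⟩
  rw [map_natCast, Polynomial.eval_sub, ← hp, ← hq, sub_self]

/-- The zeroth power map is constant with value the identity, so the polynomial of a function
vanishing at the identity has zero constant term. Products of `m` such functions give multiples of
`X ^ m`. -/
lemma exists_interpolates_of_mem_pow (hM : IsUnitriangular k ct cm M) (m : ℕ) {h : H}
    (hh : h ∈ RingHom.ker ct ^ m) : ∃ p, Polynomial.X ^ m ∣ p ∧ Interpolates ct cm h p := by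
  induction m generalizing h with
  | zero =>
    obtain ⟨p, hp⟩ := exists_interpolates hM h
    exact ⟨p, by simp, hp⟩
  | succ m ih =>
    rw [pow_succ] at hh
    induction hh using Submodule.mul_induction_on' with
    | mem_mul_mem x hx y hy =>
      obtain ⟨p, hdvd, hp⟩ := ih hx
      obtain ⟨q, hq⟩ := exists_interpolates hM y
      refine ⟨p * q, ?_, hp.mul hq⟩
      rw [pow_succ]
      refine mul_dvd_mul hdvd ?_
      have h0 := hq 0
      rw [Nat.cast_zero] at h0
      rw [Polynomial.X_dvd_iff, Polynomial.coeff_zero_eq_eval_zero, ← h0]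
      change Algebra.ofId k H (ct y) = 0
      rw [show ct y = 0 from hy, map_zero]
    | add x _ y _ hx hy =>
      obtain ⟨p, hdvd, hp⟩ := hx
      obtain ⟨q, hdvd', hq⟩ := hy
      exact ⟨p + q, dvd_add hdvd hdvd', hp.add hq⟩

/-- The unique interpolating polynomial of `h` is divisible by every power of `X`, so it is zero;
its value at `1` is `h`, since the first power map is the identity. -/
lemma eq_zero_of_forall_mem_pow (hM : IsUnitriangular k ct cm M)
    (hct : ∀ h, TensorProduct.rid k H (ct.toLinearMap.lTensor H (cm h)) = h) {h : H}
    (hh : ∀ m, h ∈ RingHom.ker ct ^ m) : h = 0 := by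
  obtain ⟨p, hp⟩ := exists_interpolates hM h
  have hp0 : p = 0 := by
    ext m
    obtain ⟨q, hdvd, hq⟩ := exists_interpolates_of_mem_pow hM (m + 1) (hh (m + 1))
    rw [hp.unique hq]
    exact Polynomial.X_pow_dvd_iff.1 hdvd m m.lt_succ_self
  rw [← powHom_one hct h, hp 1, hp0, Polynomial.eval_zero]

lemma exists_pointDer_ne_zero {y : H} (hy : ct y = 0) (hy2 : y ∉ RingHom.ker ct ^ 2) :
    ∃ p ∈ pointDer ct, p y ≠ 0 := by
  obtain ⟨g, hg, hle⟩ := Submodule.exists_le_ker_of_notMem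
    (p := (RingHom.ker ct ^ 2).restrictScalars k) hy2
  -- A functional that vanishes on `1` and on the square of the augmentation ideal is a point
  -- derivation. The correction term enforces the first condition and does not change the value at
  -- `y`, as `ct y = 0`.
  refine ⟨g - g 1 • ct.toLinearMap, fun a b => ?_, by simpa [hy] using hg⟩
  have hm : (a - algebraMap k H (ct a)) * (b - algebraMap k H (ct b)) ∈ RingHom.ker ct ^ 2 := by
    rw [pow_two]
    refine Ideal.mul_mem_mul ?_ ?_ <;> simp [RingHom.mem_ker]
  have h0 : g ((a - algebraMap k H (ct a)) * (b - algebraMap k H (ct b))) = 0 := hle hm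
  have hexp : (a - algebraMap k H (ct a)) * (b - algebraMap k H (ct b)) =
      a * b - ct a • b - ct b • a + (ct a * ct b) • 1 := by
    simp only [Algebra.smul_def, map_mul]
    ring
  rw [hexp, map_add, map_sub, map_sub, map_smul, map_smul, map_smul] at h0
  simp only [smul_eq_mul] at h0
  simp only [LinearMap.sub_apply, LinearMap.smul_apply, AlgHom.toLinearMap_apply, map_mul,
    smul_eq_mul]
  linear_combination h0

variable {J : Type*} [Fintype J] [DecidableEq J] {p : J → pointDer ct}

/-- An Euler argument at the identity: with local coordinates `x j` dual to the `p j`, the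
derivation `E = ∑ x j D_j` acts on the `m`-th graded piece of the augmentation filtration as
multiplication by `m`. In characteristic zero an element of the augmentation ideal killed by `E`
lies in all powers of that ideal, hence is zero. -/
lemma eq_algebraMap_of_forall_coDer_eq_zero (hM : IsUnitriangular k ct cm M)
    (hct : ∀ h, TensorProduct.rid k H (ct.toLinearMap.lTensor H (cm h)) = h)
    (hcm : IsCoaction ct cm cm) (hli : LinearIndependent k fun j => (p j).1)
    (hsp : pointDer ct ≤ Submodule.span k (Set.range fun j => (p j).1)) {h : H} (hh : ∀ j, coDer hcm (p j) h = 0) :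
    h = algebraMap k H (ct h) := by
  obtain ⟨x', hx'⟩ := exists_dual_vectors hli
  let x : J → H := fun j => x' j - algebraMap k H (ct (x' j))
  have hp1 : ∀ (q : pointDer ct) (c : k), q.1 (algebraMap k H c) = 0 := fun q c => by
    rw [Algebra.algebraMap_eq_smul_one, map_smul, pointDer_one q.2, smul_zero]
  have hx : ∀ i j, (p i).1 (x j) = if i = j then 1 else 0 := fun i j => by
    change (p i).1 (x' j - algebraMap k H (ct (x' j))) = _
    rw [map_sub, hp1, sub_zero, hx']
  have hxm : ∀ j, x j ∈ RingHom.ker ct := fun j => by simp [x, RingHom.mem_ker]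
  have hct' : ∀ (q : pointDer ct) (y : H), ct (coDer hcm q y) = q.1 y := fun q y => by
    rw [coDer_apply]
    conv_rhs => rw [← hct y]
    induction cm y with
    | zero => simp
    | tmul g g' => simp [mul_comm]
    | add x y hx hy => simp only [map_add, hx, hy]
  -- The `x j` span the cotangent space: the difference is killed by all the `p j`, hence by all
  -- point derivations, and these detect nonzero classes modulo the square.
  have hsq : ∀ y ∈ RingHom.ker ct, y - ∑ j, (p j).1 y • x j ∈ RingHom.ker ct ^ 2 := by
    intro y hy
    by_contra hne
    have hmem : ∑ j, (p j).1 y • x j ∈ RingHom.ker ct := by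
      refine Ideal.sum_mem _ fun j _ => ?_
      rw [Algebra.smul_def]
      exact Ideal.mul_mem_left _ _ (hxm j)
    obtain ⟨q, hq, hq0⟩ := exists_pointDer_ne_zero (sub_mem hy hmem : _ ∈ RingHom.ker ct) hne
    apply hq0
    let ev : (H →ₗ[k] k) →ₗ[k] k := LinearMap.applyₗ (y - ∑ j, (p j).1 y • x j)
    suffices H : Submodule.span k (Set.range fun j => (p j).1) ≤ LinearMap.ker ev from H (hsp hq)
    rw [Submodule.span_le]
    rintro _ ⟨i, rfl⟩
    change (p i).1 (y - ∑ j, (p j).1 y • x j) = 0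
    rw [map_sub, map_sum]
    simp [hx]
  let E : Derivation k H H := ∑ j, x j • coDer hcm (p j)
  have hE : ∀ y, E y = ∑ j, x j * coDer hcm (p j) y := fun y => by
    change (Derivation.coeFnAddMonoidHom (∑ j, x j • coDer hcm (p j))) y = _
    rw [map_sum, Finset.sum_apply]
    rfl
  have hE1 : ∀ y ∈ RingHom.ker ct, E y - y ∈ RingHom.ker ct ^ 2 := by
    intro y hy
    have h1 : E y - y = ∑ j, x j * (coDer hcm (p j) y - algebraMap k H ((p j).1 y)) -
        (y - ∑ j, (p j).1 y • x j) := by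
      rw [hE]
      simp only [mul_sub, Finset.sum_sub_distrib, Algebra.smul_def]
      simp only [mul_comm (algebraMap k H _)]
      ring
    rw [h1]
    refine sub_mem (Ideal.sum_mem _ fun j _ => ?_) (hsq y hy)
    rw [pow_two]
    refine Ideal.mul_mem_mul (hxm j) ?_
    rw [RingHom.mem_ker, map_sub, hct', AlgHom.commutes]
    simp
  have hEm : ∀ (m : ℕ) (y : H), y ∈ RingHom.ker ct ^ m →
      E y - (m : H) * y ∈ RingHom.ker ct ^ (m + 1) := by
    intro m
    induction m with
    | zero =>
      intro y _
      rw [zero_add, pow_one, Nat.cast_zero, zero_mul, sub_zero, hE]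
      exact Ideal.sum_mem _ fun j _ => Ideal.mul_mem_right _ _ (hxm j)
    | succ m ih =>
      intro y hy
      rw [pow_succ] at hy
      induction hy using Submodule.mul_induction_on' with
      | mem_mul_mem a ha b hb =>
        have h1 : E (a * b) - ((m + 1 : ℕ) : H) * (a * b) =
            (E a - m * a) * b + a * (E b - b) := by
          rw [Derivation.leibniz, smul_eq_mul, smul_eq_mul]
          push_cast
          ring
        rw [h1]
        refine add_mem ?_ ?_
        · rw [pow_succ]
          exact Ideal.mul_mem_mul (ih a ha) hb
        · rw [show m + 1 + 1 = m + 2 by ring, pow_add]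
          exact Ideal.mul_mem_mul ha (hE1 b hb)
      | add a _ b _ ha hb =>
        have h1 : E (a + b) - ((m + 1 : ℕ) : H) * (a + b) =
            (E a - ((m + 1 : ℕ) : H) * a) + (E b - ((m + 1 : ℕ) : H) * b) := by
          rw [map_add]
          ring
        rw [h1]
        exact add_mem ha hb
  set y := h - algebraMap k H (ct h) with hy
  have hEy : E y = 0 := by
    rw [hE]
    refine Finset.sum_eq_zero fun j _ => ?_
    rw [hy, map_sub, Derivation.map_algebraMap, hh, sub_zero, mul_zero]
  -- Since `E y = 0`, the multiple `(m + 1) y` lies one step deeper in the filtration, and `m + 1`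
  -- is invertible in `k`.
  have hmem : ∀ m, y ∈ RingHom.ker ct ^ (m + 1) := by
    intro m
    induction m with
    | zero => simp [hy, RingHom.mem_ker]
    | succ m ih =>
      have h1 := hEm (m + 1) y ih
      rw [hEy, zero_sub] at h1
      have h2 := neg_mem h1
      rw [neg_neg] at h2
      have hne : ((m + 1 : ℕ) : k) ≠ 0 := by exact_mod_cast m.succ_ne_zero
      have h3 : y = algebraMap k H (((m + 1 : ℕ) : k)⁻¹) * (((m + 1 : ℕ) : H) * y) := by
        rw [← mul_assoc, ← map_natCast (algebraMap k H) (m + 1), ← map_mul, inv_mul_cancel₀ hne,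
          map_one, one_mul]
      rw [h3]
      exact Ideal.mul_mem_left _ _ h2
  rw [← sub_eq_zero]
  refine eq_zero_of_forall_mem_pow hM hct fun m => ?_
  exact Ideal.pow_le_pow_right m.le_succ (hmem m)

/-- Elements of a tensor product killed by the invariant derivations are constant. -/
lemma eq_one_tmul_of_forall_leftInv_eq_zero {V : Type*} [AddCommGroup V] [Module k V]
    (hM : IsUnitriangular k ct cm M)
    (hct : ∀ h, TensorProduct.rid k H (ct.toLinearMap.lTensor H (cm h)) = h)
    (hcm : IsCoaction ct cm cm) (hli : LinearIndependent k fun j => (p j).1)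
    (hsp : pointDer ct ≤ Submodule.span k (Set.range fun j => (p j).1)) {x : H ⊗[k] V}
    (hx : ∀ j, (leftInv cm (p j).1).rTensor V x = 0) :
    x = 1 ⊗ₜ contract ct.toLinearMap V x := by
  -- Functionals on `V` commute with the operators on the factor `H`, which reduces the claim to
  -- functions on the group; the coordinates of a basis of `V` then recover `x`.
  have key : ∀ g : V →ₗ[k] k, TensorProduct.rid k H (g.lTensor H x) =
      TensorProduct.rid k H (g.lTensor H (1 ⊗ₜ contract ct.toLinearMap V x)) := by
    intro g
    have h1 : ∀ j, coDer hcm (p j) (TensorProduct.rid k H (g.lTensor H x)) = 0 := by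
      intro j
      have h2 : ∀ z : H ⊗[k] V, leftInv cm (p j).1 (TensorProduct.rid k H (g.lTensor H z)) =
          TensorProduct.rid k H (g.lTensor H ((leftInv cm (p j).1).rTensor V z)) := by
        intro z
        induction z with
        | zero => simp
        | tmul h v => simp
        | add z w hz hw => simp only [map_add, hz, hw]
      refine (h2 x).trans ?_
      rw [hx, map_zero, map_zero]
    rw [eq_algebraMap_of_forall_coDer_eq_zero hM hct hcm hli hsp h1]
    have h3 : ∀ z : H ⊗[k] V, algebraMap k H (ct (TensorProduct.rid k H (g.lTensor H z))) =
        TensorProduct.rid k H (g.lTensor H (1 ⊗ₜ contract ct.toLinearMap V z)) := by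
      intro z
      induction z with
      | zero => simp
      | tmul h v => simp [Algebra.smul_def, mul_comm]
      | add z w hz hw => simp only [map_add, TensorProduct.tmul_add, hz, hw]
    exact h3 x
  classical
  let b := Module.Basis.ofVectorSpace k V
  refine (TensorProduct.equivFinsuppOfBasisRight b).injective (Finsupp.ext fun i => ?_)
  have := key (b.coord i)
  have h4 : ∀ z : H ⊗[k] V, TensorProduct.equivFinsuppOfBasisRight b z i =
      TensorProduct.rid k H ((b.coord i).lTensor H z) := by
    intro z
    induction z with
    | zero => simp
    | tmul h v => simp
    | add z w hz hw => simp only [map_add, Finsupp.add_apply, hz, hw]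
  rw [h4, h4, this]

/-- By the intertwining relation `co a` is killed by the invariant derivations of `H`, so it is
constant along the group. Infinitesimal invariance thus implies invariance. -/
lemma coaction_eq_one_tmul_of_forall_coDer_eq_zero {A : Type*} [CommRing A] [Algebra k A]
    {co : A →ₐ[k] H ⊗[k] A} (hco : IsCoaction ct cm co) (hM : IsUnitriangular k ct cm M)
    (hct : ∀ h, TensorProduct.rid k H (ct.toLinearMap.lTensor H (cm h)) = h)
    (hcm : IsCoaction ct cm cm) (hli : LinearIndependent k fun j => (p j).1)
    (hsp : pointDer ct ≤ Submodule.span k (Set.range fun j => (p j).1)) {a : A} (ha : ∀ j, coDer hco (p j) a = 0) :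
    co a = 1 ⊗ₜ a := by
  conv_rhs => rw [← hco.counit a]
  refine eq_one_tmul_of_forall_leftInv_eq_zero hM hct hcm hli hsp fun j => ?_
  rw [leftInv_rTensor_coaction hco, ← coDer_apply hco, ha, map_zero]

/-- The space of point derivations is spanned by finitely many linearly independent elements of any
spanning set. -/
lemma exists_finite_basis_of_span (hM : IsUnitriangular k ct cm M) {S : Set (H →ₗ[k] k)}
    (hS : S ⊆ pointDer ct) (hsp : pointDer ct ≤ Submodule.span k S) :
    ∃ T ⊆ S, Finite T ∧ LinearIndependent k ((↑) : T → H →ₗ[k] k) ∧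
      pointDer ct ≤ Submodule.span k (Set.range ((↑) : T → H →ₗ[k] k)) := by
  let ev : (H →ₗ[k] k) →ₗ[k] (Fin n × Fin n → k) :=
    LinearMap.pi fun q => LinearMap.applyₗ (M q.1 q.2)
  -- A point derivation is determined by its values on the finitely many generators `M i j`, so the
  -- space of point derivations is finite-dimensional.
  have hev : Set.InjOn ev (pointDer ct) := by
    intro q hq q' hq' hqq
    ext h
    have hh : h ∈ Algebra.adjoin k (Set.range fun p : Fin n × Fin n => M p.1 p.2) := by
      rw [hM.adjoin]; trivial
    induction hh using Algebra.adjoin_induction with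
    | mem x hx =>
      obtain ⟨i, rfl⟩ := hx
      exact congrFun hqq i
    | algebraMap c =>
      rw [Algebra.algebraMap_eq_smul_one, map_smul, map_smul, pointDer_one hq, pointDer_one hq']
    | add x y _ _ hx hy => rw [map_add, map_add, hx, hy]
    | mul x y _ _ hx hy => rw [hq, hq', hx, hy]
  obtain ⟨T, hTS, hspan, hli⟩ := exists_linearIndependent k S
  refine ⟨T, hTS, ?_, hli, ?_⟩
  · have h1 : LinearIndependent k (ev ∘ ((↑) : T → H →ₗ[k] k)) := by
      refine hli.map_injOn ev (hev.mono ?_)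
      rw [Subtype.range_coe, hspan]
      exact Submodule.span_le.2 hS
    exact h1.finite
  · rwa [Subtype.range_coe, hspan]

end Unipotent

/-! ### Coactions with an invertible matrix of derivatives -/

section SliceDer

open TensorProduct

variable {k H A : Type*} [Field k] [CommRing H] [Algebra k H] [CommRing A] [Algebra k A]
  {ct : H →ₐ[k] k} {cm : H →ₐ[k] H ⊗[k] H} {co : A →ₐ[k] H ⊗[k] A}
  (hco : IsCoaction ct cm co) {J : Type*} [Fintype J] [DecidableEq J] (p : J → pointDer ct)

/-- The matrix of the derivatives of the functions `f`. -/
noncomputable def derMatrix (f : J → A) : Matrix J J A :=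
  Matrix.of fun i j => coDer hco (p i) (f j)

/-- The combinations of the derivations `coDer hco (p i)` with coefficients `W`. -/
noncomputable def sliceDer (W : Matrix J J A) (j : J) : Derivation k A A :=
  ∑ i, W j i • coDer hco (p i)

variable {hco p} {f : J → A} {W : Matrix J J A}

lemma sliceDer_apply (j : J) (a : A) :
    sliceDer hco p W j a = ∑ i, W j i * coDer hco (p i) a := by
  change (Derivation.coeFnAddMonoidHom (∑ i, W j i • coDer hco (p i))) a = _
  rw [map_sum, Finset.sum_apply]
  rfl

lemma sliceDer_slice (hW : W * derMatrix hco p f = 1) (i j : J) :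
    sliceDer hco p W i (f j) = if i = j then 1 else 0 := by
  rw [sliceDer_apply, ← Matrix.one_apply, ← hW, Matrix.mul_apply]
  rfl

lemma coDer_eq_sum (hW : W * derMatrix hco p f = 1) (i : J) (a : A) :
    coDer hco (p i) a = ∑ j, derMatrix hco p f i j * sliceDer hco p W j a := by
  have h1 : (derMatrix hco p f * W).mulVec (fun l => coDer hco (p l) a) i =
      coDer hco (p i) a := by
    rw [mul_eq_one_comm.1 hW, Matrix.one_mulVec]
  rw [← h1, ← Matrix.mulVec_mulVec]
  simp only [Matrix.mulVec, dotProduct, sliceDer_apply]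

lemma coDer_eq_zero_of_sliceDer (hW : W * derMatrix hco p f = 1) {a : A}
    (ha : ∀ j, sliceDer hco p W j a = 0) (i : J) : coDer hco (p i) a = 0 := by
  rw [coDer_eq_sum hW]
  exact Finset.sum_eq_zero fun j _ => by rw [ha, mul_zero]

lemma lie_smul_derivation (X Y : Derivation k A A) (b : A) :
    ⁅X, b • Y⁆ = X b • Y + b • ⁅X, Y⁆ := by
  ext a
  rw [Derivation.commutator_apply (D1 := X) (D2 := b • Y), Derivation.add_apply,
    Derivation.smul_apply, Derivation.smul_apply, Derivation.smul_apply, Derivation.smul_apply,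
    Derivation.commutator_apply (D1 := X) (D2 := Y), smul_eq_mul, Derivation.leibniz]
  simp only [smul_eq_mul]
  ring

/-- On the generators this is closure of `Lie U` under the bracket, with structure constants in `k`;
the Leibniz rule for the bracket extends it to coefficients in `A`. -/
lemma lie_mem_span (hcm : IsCoaction ct cm cm)
    (hsp : pointDer ct ≤ Submodule.span k (Set.range fun j => (p j).1)) {X Y : Derivation k A A}
    (hX : X ∈ Submodule.span A (Set.range fun j => coDer hco (p j)))
    (hY : Y ∈ Submodule.span A (Set.range fun j => coDer hco (p j))) :
    ⁅X, Y⁆ ∈ Submodule.span A (Set.range fun j => coDer hco (p j)) := by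
  have hbase : ∀ i j, ⁅coDer hco (p i), coDer hco (p j)⁆ ∈
      Submodule.span A (Set.range fun j => coDer hco (p j)) := by
    intro i j
    obtain ⟨c, hc⟩ := (Submodule.mem_span_range_iff_exists_fun k).1
      (hsp (pointBracket hcm (p i) (p j)).2)
    have h1 : ⁅coDer hco (p i), coDer hco (p j)⁆ =
        ∑ l, algebraMap k A (c l) • coDer hco (p l) := by
      ext a
      rw [Derivation.commutator_apply (D1 := coDer hco (p i)) (D2 := coDer hco (p j)),
        ← coDer_pointBracket hcm hco, coDer_apply, ← hc, contract_sum]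
      change _ = (Derivation.coeFnAddMonoidHom (∑ l, algebraMap k A (c l) • coDer hco (p l))) a
      rw [map_sum, Finset.sum_apply]
      refine Finset.sum_congr rfl fun l _ => ?_
      rw [Algebra.smul_def]
      rfl
    rw [h1]
    exact Submodule.sum_mem _ fun l _ => Submodule.smul_mem _ _ (Submodule.subset_span ⟨l, rfl⟩)
  have hleft : ∀ i, ∀ Y ∈ Submodule.span A (Set.range fun j => coDer hco (p j)),
      ⁅coDer hco (p i), Y⁆ ∈ Submodule.span A (Set.range fun j => coDer hco (p j)) := by
    intro i Y hY
    induction hY using Submodule.span_induction with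
    | mem Y hY => obtain ⟨j, rfl⟩ := hY; exact hbase i j
    | zero => rw [lie_zero]; exact Submodule.zero_mem _
    | add Y Z _ _ hY hZ => rw [lie_add]; exact Submodule.add_mem _ hY hZ
    | smul b Y hY hY' =>
      rw [lie_smul_derivation]
      exact Submodule.add_mem _ (Submodule.smul_mem _ _ hY) (Submodule.smul_mem _ _ hY')
  rw [← lie_skew]
  refine Submodule.neg_mem _ ?_
  induction hX using Submodule.span_induction with
  | mem X hX =>
    obtain ⟨j, rfl⟩ := hX
    rw [← lie_skew]
    exact Submodule.neg_mem _ (hleft j Y hY)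
  | zero => rw [lie_zero]; exact Submodule.zero_mem _
  | add X Z _ _ hX hZ => rw [lie_add]; exact Submodule.add_mem _ hX hZ
  | smul b X hX hX' =>
    rw [lie_smul_derivation]
    exact Submodule.add_mem _ (Submodule.smul_mem _ _ hX) (Submodule.smul_mem _ _ hX')

/-- The bracket is `∑ c l • D_l` and kills every `f m`, because the slice derivations take the
constant values `0` and `1` on the slices. So `c` is annihilated by the invertible matrix of
derivatives. -/
lemma sliceDer_commute (hcm : IsCoaction ct cm cm)
    (hsp : pointDer ct ≤ Submodule.span k (Set.range fun j => (p j).1))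
    (hW : W * derMatrix hco p f = 1) (i j : J) (a : A) :
    sliceDer hco p W i (sliceDer hco p W j a) = sliceDer hco p W j (sliceDer hco p W i a) := by
  have hmem : ∀ j, sliceDer hco p W j ∈ Submodule.span A (Set.range fun j => coDer hco (p j)) :=
    fun j => Submodule.sum_mem _ fun l _ => Submodule.smul_mem _ _ (Submodule.subset_span ⟨l, rfl⟩)
  obtain ⟨c, hc⟩ := (Submodule.mem_span_range_iff_exists_fun A).1
    (lie_mem_span hcm hsp (hmem i) (hmem j))
  have happ : ∀ b, ⁅sliceDer hco p W i, sliceDer hco p W j⁆ b = ∑ l, c l * coDer hco (p l) b := by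
    intro b
    rw [← hc]
    change (Derivation.coeFnAddMonoidHom (∑ l, c l • coDer hco (p l))) b = _
    rw [map_sum, Finset.sum_apply]
    rfl
  have h0 : Matrix.vecMul c (derMatrix hco p f) = 0 := by
    ext m
    have := happ (f m)
    rw [Derivation.commutator_apply (D1 := sliceDer hco p W i) (D2 := sliceDer hco p W j),
      sliceDer_slice hW, sliceDer_slice hW] at this
    refine this.symm.trans ?_
    split_ifs <;> simp
  have hc0 : c = 0 := by
    rw [← Matrix.vecMul_one c, ← mul_eq_one_comm.1 hW, ← Matrix.vecMul_vecMul, h0,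
      Matrix.zero_vecMul]
  have := happ a
  rw [Derivation.commutator_apply (D1 := sliceDer hco p W i) (D2 := sliceDer hco p W j), hc0,
    sub_eq_iff_eq_add] at this
  simpa using this

end SliceDer

/-! ### Trivialisation of a coaction by slices -/

section Trivialization

open TensorProduct

variable {k H A B : Type*} [Field k] [CommRing H] [Algebra k H] [CommRing A] [Algebra k A]
  [CommRing B] [Algebra k B] {ct : H →ₐ[k] k} {cm : H →ₐ[k] H ⊗[k] H}

/-- The subalgebra of coinvariants. -/
def coinv (co : A →ₐ[k] H ⊗[k] A) : Subalgebra k A :=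
  AlgHom.equalizer co Algebra.TensorProduct.includeRight

lemma mem_coinv {co : A →ₐ[k] H ⊗[k] A} {a : A} : a ∈ coinv co ↔ co a = 1 ⊗ₜ a := Iff.rfl

lemma coDer_equivariant {co : A →ₐ[k] H ⊗[k] A} {co' : B →ₐ[k] H ⊗[k] B}
    (hco : IsCoaction ct cm co) (hco' : IsCoaction ct cm co') {g : A →ₐ[k] B}
    (hg : ∀ a, co' (g a) = g.toLinearMap.lTensor H (co a)) (p : pointDer ct) (a : A) :
    coDer hco' p (g a) = g (coDer hco p a) := by
  rw [coDer_apply, coDer_apply, hg, contract_lTensor]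
  rfl

variable (B cm) in
/-- The coaction on `H ⊗ B` through the first factor. -/
noncomputable def freeCoaction : H ⊗[k] B →ₐ[k] H ⊗[k] (H ⊗[k] B) :=
  (Algebra.TensorProduct.assoc k k k H H B).toAlgHom.comp
    (Algebra.TensorProduct.map cm (AlgHom.id k B))

lemma freeCoaction_apply (x : H ⊗[k] B) :
    freeCoaction B cm x = TensorProduct.assoc k H H B (cm.toLinearMap.rTensor B x) := by
  induction x with
  | zero => simp
  | tmul h b => rfl
  | add x y hx hy => simp only [map_add, hx, hy]

lemma isCoaction_free (hcm : IsCoaction ct cm cm) : IsCoaction ct cm (freeCoaction B cm) where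
  coassoc x := by
    rw [freeCoaction_apply]
    induction x with
    | zero => simp
    | add x y hx hy => simp only [map_add, hx, hy]
    | tmul h b =>
      let e : H →ₗ[k] H ⊗[k] B := (TensorProduct.mk k H B).flip b
      have h1 : ∀ w : H ⊗[k] H, TensorProduct.assoc k H H (H ⊗[k] B) (cm.toLinearMap.rTensor _
          (TensorProduct.assoc k H H B (w ⊗ₜ b))) = (e.lTensor H).lTensor H
            (TensorProduct.assoc k H H H (cm.toLinearMap.rTensor H w)) := by
        intro w
        induction w with
        | zero => simp
        | add x y hx hy => simp only [map_add, TensorProduct.add_tmul, hx, hy]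
        | tmul x y =>
          simp only [TensorProduct.assoc_tmul, LinearMap.rTensor_tmul, AlgHom.toLinearMap_apply]
          induction cm x with
          | zero => simp
          | add u v hu hv => simp only [map_add, TensorProduct.add_tmul, hu, hv]
          | tmul u v => rfl
      have h2 : ∀ w : H ⊗[k] H, (freeCoaction B cm).toLinearMap.lTensor H
          (TensorProduct.assoc k H H B (w ⊗ₜ b)) = (e.lTensor H).lTensor H
            (cm.toLinearMap.lTensor H w) := by
        intro w
        induction w with
        | zero => simp
        | add x y hx hy => simp only [map_add, TensorProduct.add_tmul, hx, hy]
        | tmul x y =>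
          simp only [TensorProduct.assoc_tmul, LinearMap.lTensor_tmul, AlgHom.toLinearMap_apply,
            freeCoaction_apply, LinearMap.rTensor_tmul]
          congr 1
          induction cm y with
          | zero => simp
          | add u v hu hv => simp only [map_add, TensorProduct.add_tmul, hu, hv]
          | tmul u v => rfl
      rw [LinearMap.rTensor_tmul, AlgHom.toLinearMap_apply, h1, h2, hcm.coassoc]
  counit x := by
    rw [freeCoaction_apply, contract_assoc, ← LinearMap.rTensor_comp_apply]
    have : contract ct.toLinearMap H ∘ₗ cm.toLinearMap = LinearMap.id :=
      LinearMap.ext hcm.counit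
    rw [this, LinearMap.rTensor_id_apply]

lemma coDer_free (hcm : IsCoaction ct cm cm) (p : pointDer ct) (x : H ⊗[k] B) :
    coDer (isCoaction_free (B := B) hcm) p x = (leftInv cm p.1).rTensor B x := by
  rw [coDer_apply, freeCoaction_apply, contract_assoc, ← LinearMap.rTensor_comp_apply]
  rfl

variable {co : A →ₐ[k] H ⊗[k] A}

/-- The homomorphism `A → H ⊗ B` that corresponds to the orbit map of a homomorphism `A → B`. -/
noncomputable def orbitHom (co : A →ₐ[k] H ⊗[k] A) (r : A →ₐ[k] B) : A →ₐ[k] H ⊗[k] B :=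
  (Algebra.TensorProduct.map (AlgHom.id k H) r).comp co

lemma orbitHom_apply (r : A →ₐ[k] B) (a : A) :
    orbitHom co r a = r.toLinearMap.lTensor H (co a) := by
  change Algebra.TensorProduct.map (AlgHom.id k H) r (co a) = _
  induction co a with
  | zero => simp
  | tmul h b => rfl
  | add x y hx hy => simp only [map_add, hx, hy]

/-- Equivariance of `(u, y) ↦ u • s(y)`, where `s` is the map of spectra dual to `r`; it comes down
to coassociativity. -/
lemma freeCoaction_orbitHom (hco : IsCoaction ct cm co) (r : A →ₐ[k] B) (a : A) :
    freeCoaction B cm (orbitHom co r a) = (orbitHom co r).toLinearMap.lTensor H (co a) := by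
  have h1 : ∀ w : H ⊗[k] A, TensorProduct.assoc k H H B (cm.toLinearMap.rTensor B
      (r.toLinearMap.lTensor H w)) = (r.toLinearMap.lTensor H).lTensor H
        (TensorProduct.assoc k H H A (cm.toLinearMap.rTensor A w)) := by
    intro w
    induction w with
    | zero => simp
    | add x y hx hy => simp only [map_add, hx, hy]
    | tmul x y =>
      simp only [LinearMap.lTensor_tmul, LinearMap.rTensor_tmul, AlgHom.toLinearMap_apply]
      induction cm x with
      | zero => simp
      | add u v hu hv => simp only [map_add, TensorProduct.add_tmul, hu, hv]
      | tmul u v => rfl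
  have h2 : (orbitHom co r).toLinearMap = r.toLinearMap.lTensor H ∘ₗ co.toLinearMap :=
    LinearMap.ext fun a => orbitHom_apply r a
  rw [freeCoaction_apply, orbitHom_apply, h1, hco.coassoc, h2, LinearMap.lTensor_comp_apply]

variable [CharZero k] {J : Type*} [Fintype J] [DecidableEq J] {p : J → pointDer ct} {n : ℕ}
  {M : Matrix (Fin n) (Fin n) H} {f : J → A} {W : Matrix J J A}

/-- A coaction of a unipotent Hopf algebra for which the matrix of derivatives of some functions is
invertible and the corresponding derivations are locally nilpotent is free. -/
theorem exists_retraction_bijective_orbitHom (hco : IsCoaction ct cm co)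
    (hM : IsUnitriangular k ct cm M)
    (hct : ∀ h, TensorProduct.rid k H (ct.toLinearMap.lTensor H (cm h)) = h)
    (hcm : IsCoaction ct cm cm) (hli : LinearIndependent k fun j => (p j).1)
    (hsp : pointDer ct ≤ Submodule.span k (Set.range fun j => (p j).1))
    (hW : W * derMatrix hco p f = 1) (hnil : ∀ j a, ∃ N, (sliceDer hco p W j)^[N] a = 0) :
    ∃ r : A →ₐ[k] coinv co, (∀ c : coinv co, r c = c) ∧ Function.Bijective (orbitHom co r) := by
  obtain ⟨r', hr', hr'c⟩ := exists_retraction_constants (sliceDer_commute hcm hsp hW)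
    (sliceDer_slice hW) hnil
  have hconst : ∀ a, (∀ j, sliceDer hco p W j a = 0) → a ∈ coinv co := fun a ha =>
    coaction_eq_one_tmul_of_forall_coDer_eq_zero hco hM hct hcm hli hsp
      (coDer_eq_zero_of_sliceDer hW ha)
  have hcoinv : ∀ a ∈ coinv co, ∀ j, sliceDer hco p W j a = 0 := by
    intro a ha j
    rw [sliceDer_apply]
    refine Finset.sum_eq_zero fun i _ => ?_
    rw [coDer_apply, mem_coinv.1 ha, contract_tmul, pointDer_one (p i).2, zero_smul, mul_zero]
  let r : A →ₐ[k] coinv co := r'.codRestrict (coinv co) fun a => hconst _ fun j => hr' j a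
  have hrc : ∀ c : coinv co, r c = c := fun c => Subtype.ext (hr'c c (hcoinv c c.2))
  let t := orbitHom co r
  have htc : ∀ c : coinv co, t c = 1 ⊗ₜ c := fun c => by
    rw [orbitHom_apply, mem_coinv.1 c.2, LinearMap.lTensor_tmul]
    exact congrArg _ (hrc c)
  let hB := isCoaction_free (B := coinv co) hcm
  have ht : ∀ q a, coDer hB q (t a) = t (coDer hco q a) :=
    coDer_equivariant hco hB (freeCoaction_orbitHom hco r)
  have hWB : W.map t * derMatrix hB p (t ∘ f) = 1 := by
    have h1 : derMatrix hB p (t ∘ f) = (derMatrix hco p f).map t := by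
      ext i j
      exact ht _ _
    rw [h1]
    change W.map t.toRingHom * (derMatrix hco p f).map t.toRingHom = 1
    rw [← Matrix.map_mul, hW, Matrix.map_one _ (map_zero _) (map_one _)]
  have htd : ∀ j a, sliceDer hB p (W.map t) j (t a) = t (sliceDer hco p W j a) := fun j a => by
    rw [sliceDer_apply, sliceDer_apply, map_sum]
    refine Finset.sum_congr rfl fun i _ => ?_
    rw [ht, map_mul]
    rfl
  have htd' : ∀ j N a, (sliceDer hB p (W.map t) j)^[N] (t a) = t ((sliceDer hco p W j)^[N] a) := by
    intro j N
    induction N with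
    | zero => exact fun a => rfl
    | succ N ih => exact fun a => by rw [Function.iterate_succ_apply, htd, ih]; rfl
  have hnilB : ∀ j (b : H ⊗[k] coinv co), b ∈ nilSubalgebra k (sliceDer hB p (W.map t) j) := by
    intro j
    have hta : ∀ a, t a ∈ nilSubalgebra k (sliceDer hB p (W.map t) j) := fun a => by
      obtain ⟨N, hN⟩ := hnil j a
      exact ⟨N, by rw [htd', hN, map_zero]⟩
    -- An invariant derivation sends `M i l` to a combination of the `M s l` with `s > i`: the
    -- entries `M i s` with `s ≤ i` are `0` or `1` and are killed by point derivations. Induction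
    -- therefore proceeds from the last row upwards.
    have hmat : ∀ (m : ℕ) (i l : Fin n), n - i = m →
        M i l ⊗ₜ[k] (1 : coinv co) ∈ nilSubalgebra k (sliceDer hB p (W.map t) j) := by
      intro m
      induction m using Nat.strong_induction_on with
      | _ m ih =>
        intro i l him
        refine mem_nilSubalgebra_of_apply_mem ?_
        rw [sliceDer_apply]
        refine Subalgebra.sum_mem _ fun q _ => Subalgebra.mul_mem _ (hta _) ?_
        rw [coDer_free hcm, LinearMap.rTensor_tmul, leftInv, LinearMap.comp_apply,
          AlgHom.toLinearMap_apply, hM.comul, map_sum, TensorProduct.sum_tmul]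
        refine Subalgebra.sum_mem _ fun s _ => ?_
        rw [contract_tmul, ← TensorProduct.smul_tmul']
        rcases lt_trichotomy s i with h | rfl | h
        · rw [hM.lower i s h, map_zero, zero_smul]
          exact Subalgebra.zero_mem _
        · rw [hM.diag, pointDer_one (p q).2, zero_smul]
          exact Subalgebra.zero_mem _
        · exact Subalgebra.smul_mem _ (ih (n - s) (by omega) s l rfl) _
    intro b
    induction b with
    | zero => exact Subalgebra.zero_mem _
    | add x y hx hy => exact Subalgebra.add_mem _ hx hy
    | tmul h c =>
      have h1 : h ⊗ₜ[k] c = h ⊗ₜ 1 * 1 ⊗ₜ c := by simp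
      rw [h1, ← htc]
      refine Subalgebra.mul_mem _ ?_ (hta _)
      have hh : h ∈ Algebra.adjoin k (Set.range fun p : Fin n × Fin n => M p.1 p.2) := by
        rw [hM.adjoin]; trivial
      suffices Algebra.adjoin k (Set.range fun p : Fin n × Fin n => M p.1 p.2) ≤
        (nilSubalgebra k (sliceDer hB p (W.map t) j)).comap
          Algebra.TensorProduct.includeLeft from this hh
      rw [Algebra.adjoin_le_iff]
      rintro _ ⟨⟨i, l⟩, rfl⟩
      exact hmat _ i l rfl
  have hconstB : ∀ b, (∀ j, sliceDer hB p (W.map t) j b = 0) → b ∈ t.range := by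
    intro b hb
    have h1 := eq_one_tmul_of_forall_leftInv_eq_zero hM hct hcm hli hsp (x := b) fun j => by
      rw [← coDer_free hcm, coDer_eq_zero_of_sliceDer hWB hb]
    rw [h1, ← htc]
    exact ⟨_, rfl⟩
  refine ⟨r, hrc, ?_, ?_⟩
  -- The kernel of `t` is stable under the slice derivations, and contains no nonzero constant
  -- because `t c = 1 ⊗ c` for coinvariants `c`.
  · refine (injective_iff_map_eq_zero t).2 fun a ha => ?_
    refine eq_zero_of_constants (sliceDer_commute hcm hsp hW) hnil (S := {a | t a = 0})
      (fun i a ha => ?_) (fun a ha h => ?_) ha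
    · change t _ = 0
      rw [← htd, show t a = 0 from ha, map_zero]
    · have h1 := htc ⟨a, hconst a h⟩
      rw [show t a = 0 from ha] at h1
      have h2 := congrArg (contract ct.toLinearMap (coinv co)) h1
      rw [map_zero, contract_tmul, AlgHom.toLinearMap_apply, map_one, one_smul] at h2
      exact congrArg Subtype.val h2.symm
  -- The range of `t` contains the constants, which are of the form `1 ⊗ c`, and the slices `t (f
  -- i)`.
  · intro b
    exact mem_of_slices_mem (sliceDer_commute hcm hsp hWB) (sliceDer_slice hWB) hnilB t.range
      hconstB (fun i => ⟨f i, rfl⟩) b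

end Trivialization

/-! ### Gradings given by actions of the multiplicative group -/

section Grading

variable {k A : Type*} [Field k] [CommRing A] [Algebra k A]

/-- Evaluation of Laurent polynomials at `t`. -/
noncomputable def laurentEval (A : Type*) [CommRing A] [Algebra k A] (t : kˣ) :
    A[T;T⁻¹] →ₐ[k] A where
  __ := LaurentPolynomial.eval₂ (RingHom.id A) (Units.map (algebraMap k A).toMonoidHom t)
  commutes' c := by
    change LaurentPolynomial.eval₂ _ _ (LaurentPolynomial.C (algebraMap k A c)) = _
    rw [LaurentPolynomial.eval₂_C]
    rfl

lemma laurentEval_C_mul_T (t : kˣ) (a : A) (n : ℤ) :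
    laurentEval A t (LaurentPolynomial.C a * LaurentPolynomial.T n) = ((t ^ n : kˣ) : k) • a := by
  refine (LaurentPolynomial.eval₂_C_mul_T _ _ a n).trans ?_
  rw [← map_zpow, Algebra.smul_def, mul_comm]
  rfl

lemma coeff_C_mul_T (a : A) (n m : ℤ) :
    (LaurentPolynomial.C a * LaurentPolynomial.T n).coeff m = if n = m then a else 0 := by
  rw [← LaurentPolynomial.single_eq_C_mul_T, AddMonoidAlgebra.coeff_single, Finsupp.single_apply]

lemma sum_coeff_C_mul_T (p : A[T;T⁻¹]) :
    ∑ n ∈ p.coeff.support, LaurentPolynomial.C (p.coeff n) * LaurentPolynomial.T n = p := by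
  refine LaurentPolynomial.ext fun m => ?_
  have h1 : ∀ (s : Finset ℤ) (g : ℤ → A[T;T⁻¹]), (∑ n ∈ s, g n).coeff m =
      ∑ n ∈ s, (g n).coeff m := by
    intro s g
    induction s using Finset.induction_on with
    | empty => simp
    | insert n s hn ih => rw [Finset.sum_insert hn, Finset.sum_insert hn, ← ih]; rfl
  rw [h1]
  simp only [coeff_C_mul_T, Finset.sum_ite_eq']
  split_ifs with h
  · rfl
  · exact (Finsupp.notMem_support_iff.1 h).symm

lemma laurentEval_eq_sum (t : kˣ) (p : A[T;T⁻¹]) :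
    laurentEval A t p = ∑ n ∈ p.coeff.support, ((t ^ n : kˣ) : k) • p.coeff n := by
  conv_lhs => rw [← sum_coeff_C_mul_T p]
  rw [map_sum]
  exact Finset.sum_congr rfl fun n _ => laurentEval_C_mul_T _ _ _

/-- Multiplication by a power of `T` reduces to a polynomial that vanishes at all nonzero scalars.
This lets the grading be handled through `kˣ` alone. -/
lemma laurent_eq_zero_of_eval [Infinite k] {p : A[T;T⁻¹]} (h : ∀ t : kˣ, laurentEval A t p = 0) :
    p = 0 := by
  obtain ⟨n, q, hq⟩ := LaurentPolynomial.exists_T_pow p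
  have hq0 : q = 0 := by
    refine polynomial_eq_zero_of_eval (k := k) (S := {0}ᶜ) (Set.finite_singleton 0).infinite_compl ?_
    intro t ht
    have h1 := congrArg (laurentEval A (Units.mk0 t ht)) hq
    rw [map_mul, h, zero_mul] at h1
    rw [← h1]
    refine Eq.symm ((LaurentPolynomial.eval₂_toLaurent _ _ q).trans ?_)
    rw [Polynomial.eval]
    rfl
  rw [hq0, map_zero] at hq
  exact ((LaurentPolynomial.isUnit_T (R := A) n).mul_left_eq_zero.1 hq.symm)

/-- The coaction `ka` defines an action of `kˣ` on `A`. -/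
structure IsGmAction (ka : A →ₐ[k] A[T;T⁻¹]) : Prop where
  one : ∀ a, laurentEval A (1 : kˣ) (ka a) = a
  mul : ∀ (s t : kˣ) a, laurentEval A s (ka (laurentEval A t (ka a))) = laurentEval A (s * t) (ka a)

/-- The element `a` is homogeneous of weight `n`. -/
def IsWeight (ka : A →ₐ[k] A[T;T⁻¹]) (n : ℤ) (a : A) : Prop :=
  ka a = LaurentPolynomial.C a * LaurentPolynomial.T n

variable {ka : A →ₐ[k] A[T;T⁻¹]}

lemma IsWeight.coeff {n : ℤ} {a : A} (h : IsWeight ka n a) (m : ℤ) :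
    (ka a).coeff m = if n = m then a else 0 := by
  rw [h, coeff_C_mul_T]

lemma IsWeight.coeff_self {n : ℤ} {a : A} (h : IsWeight ka n a) : (ka a).coeff n = a := by
  rw [h.coeff, if_pos rfl]

lemma IsWeight.laurentEval {n : ℤ} {a : A} (h : IsWeight ka n a) (t : kˣ) :
    laurentEval A t (ka a) = ((t ^ n : kˣ) : k) • a := by
  rw [h, laurentEval_C_mul_T]

lemma IsWeight.mul {m n : ℤ} {a b : A} (ha : IsWeight ka m a) (hb : IsWeight ka n b) :
    IsWeight ka (m + n) (a * b) := by
  rw [IsWeight, map_mul, ha, hb, LaurentPolynomial.T_add, map_mul]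
  ring

lemma isWeight_zero (n : ℤ) : IsWeight ka n 0 := by simp [IsWeight]

lemma isWeight_one : IsWeight ka 0 1 := by simp [IsWeight]

lemma IsWeight.sum {J : Type*} {n : ℤ} {s : Finset J} {a : J → A}
    (h : ∀ j ∈ s, IsWeight ka n (a j)) : IsWeight ka n (∑ j ∈ s, a j) := by
  rw [IsWeight, map_sum, map_sum, Finset.sum_mul]
  exact Finset.sum_congr rfl fun j hj => h j hj

lemma IsWeight.prod_pow {s : Finset A} {d : A → ℤ} (h : ∀ a ∈ s, IsWeight ka (d a) a) (e : A → ℕ) :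
    IsWeight ka (∑ a ∈ s, e a * d a) (∏ a ∈ s, a ^ e a) := by
  classical
  induction s using Finset.induction_on with
  | empty => exact isWeight_one
  | insert a s ha ih =>
    rw [Finset.sum_insert ha, Finset.prod_insert ha]
    refine IsWeight.mul ?_ (ih fun b hb => h b (Finset.mem_insert_of_mem hb))
    have hwa := h a (Finset.mem_insert_self a s)
    rw [IsWeight, map_pow, hwa, mul_pow, LaurentPolynomial.T_pow, map_pow]

lemma laurent_coeff_add (p q : A[T;T⁻¹]) (n : ℤ) : (p + q).coeff n = p.coeff n + q.coeff n := rfl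

variable (ka) in
/-- The projection to the homogeneous component of weight `n`. -/
noncomputable def weightProj (n : ℤ) : A →ₗ[k] A where
  toFun a := (ka a).coeff n
  map_add' a b := by rw [map_add]; rfl
  map_smul' c a := by rw [map_smul]; rfl

variable [Infinite k]

lemma isWeight_iff {n : ℤ} {a : A} :
    IsWeight ka n a ↔ ∀ t : kˣ, laurentEval A t (ka a) = ((t ^ n : kˣ) : k) • a := by
  refine ⟨fun h t => h.laurentEval t, fun h => ?_⟩
  rw [IsWeight, ← sub_eq_zero]
  refine laurent_eq_zero_of_eval (k := k) fun t => ?_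
  rw [map_sub, h, laurentEval_C_mul_T, sub_self]

lemma IsGmAction.isWeight_coeff (hka : IsGmAction ka) (a : A) (n : ℤ) :
    IsWeight ka n ((ka a).coeff n) := by
  by_cases hn : n ∈ (ka a).coeff.support
  · rw [isWeight_iff]
    intro s
    -- The defect from being of weight `m` at the element `s`. The Laurent polynomial with
    -- coefficients `g m` vanishes at every `t`, since acting by `t` and `s` in turn is acting by `s
    -- * t`.
    let g : ℤ → A := fun m => laurentEval A s (ka ((ka a).coeff m)) -
      ((s ^ m : kˣ) : k) • (ka a).coeff m
    have h0 : ∑ m ∈ (ka a).coeff.support, LaurentPolynomial.C (g m) * LaurentPolynomial.T m = 0 := by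
      refine laurent_eq_zero_of_eval (k := k) fun t => ?_
      have h1 := hka.mul s t a
      rw [laurentEval_eq_sum t (ka a), laurentEval_eq_sum (s * t) (ka a), map_sum, map_sum] at h1
      rw [map_sum, ← sub_eq_zero.2 h1, ← Finset.sum_sub_distrib]
      refine Finset.sum_congr rfl fun m _ => ?_
      rw [laurentEval_C_mul_T, map_smul, map_smul, mul_zpow, Units.val_mul, mul_comm, mul_smul,
        ← smul_sub]
    have h2 := congrArg (fun p : A[T;T⁻¹] => p.coeff n) h0
    have h3 : ∀ s : Finset ℤ, (∑ m ∈ s, LaurentPolynomial.C (g m) * LaurentPolynomial.T m).coeff n =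
        if n ∈ s then g n else 0 := by
      intro s
      induction s using Finset.induction_on with
      | empty => simp
      | insert m s hm ih =>
        rw [Finset.sum_insert hm, laurent_coeff_add, ih, coeff_C_mul_T]
        by_cases hmn : m = n
        · subst hmn
          simp [hm]
        · simp [hmn, Ne.symm hmn]
    simp only [h3, if_pos hn] at h2
    exact sub_eq_zero.1 h2
  · rw [Finsupp.notMem_support_iff.1 hn]
    exact isWeight_zero n

lemma IsGmAction.sum_coeff (hka : IsGmAction ka) (a : A) :
    ∑ n ∈ (ka a).coeff.support, (ka a).coeff n = a := by
  conv_rhs => rw [← hka.one a, laurentEval_eq_sum]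
  simp

/-- The relation `hD` is what a vector of weight `w` in the Lie algebra satisfies on functions; as
these are pulled back, the weight drops by `w` instead of rising. -/
lemma IsWeight.derivation {D : Derivation k A A} {w : ℤ}
    (hD : ∀ (t : kˣ) a, D (GradedUnipotent.laurentEval A t (ka a)) =
      ((t ^ w : kˣ) : k) • GradedUnipotent.laurentEval A t (ka (D a)))
    {n : ℤ} {a : A} (ha : IsWeight ka n a) : IsWeight ka (n - w) (D a) := by
  rw [isWeight_iff]
  intro t
  have h1 := hD t a
  rw [ha.laurentEval, D.map_smul] at h1
  rw [zpow_sub, Units.val_mul, mul_comm, mul_smul, h1, smul_smul, ← Units.val_mul, inv_mul_cancel,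
    Units.val_one, one_smul]

lemma coeff_derivation (hka : IsGmAction ka) {D : Derivation k A A} {w : ℤ}
    (hD : ∀ (t : kˣ) a, D (GradedUnipotent.laurentEval A t (ka a)) =
      ((t ^ w : kˣ) : k) • GradedUnipotent.laurentEval A t (ka (D a))) (a : A) (n : ℤ) :
    (ka (D a)).coeff n = D ((ka a).coeff (n + w)) := by
  change weightProj ka n (D a) = _
  conv_lhs => rw [← hka.sum_coeff a]
  rw [map_sum, map_sum]
  have h1 : ∀ m ∈ (ka a).coeff.support, weightProj ka n (D ((ka a).coeff m)) =
      if m = n + w then D ((ka a).coeff m) else 0 := fun m _ => by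
    refine (((hka.isWeight_coeff a m).derivation hD).coeff n).trans ?_
    simp only [sub_eq_iff_eq_add]
  rw [Finset.sum_congr rfl h1, Finset.sum_ite_eq']
  split_ifs with h
  · rfl
  · rw [Finsupp.notMem_support_iff.1 h, map_zero]

end Grading

/-! ### The Nullstellensatz and boundedness of weights -/

section FiniteType

variable {k A : Type*} [Field k] [CommRing A] [Algebra k A] [Algebra.FiniteType k A]

lemma exists_algHom_ker_eq [IsAlgClosed k] (m : Ideal A) [hm : m.IsMaximal] :
    ∃ x : A →ₐ[k] k, RingHom.ker x = m := by
  let _ : Field (A ⧸ m) := Ideal.Quotient.field m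
  have : Algebra.FiniteType k (A ⧸ m) :=
    Algebra.FiniteType.of_surjective (Ideal.Quotient.mkₐ k m) (Ideal.Quotient.mkₐ_surjective k m)
  have : Module.Finite k (A ⧸ m) := finite_of_finite_type_of_isJacobsonRing k (A ⧸ m)
  have hb : Function.Bijective (algebraMap k (A ⧸ m)) :=
    IsAlgClosed.algebraMap_bijective_of_isIntegral
  let e := AlgEquiv.ofBijective (Algebra.ofId k (A ⧸ m)) hb
  refine ⟨e.symm.toAlgHom.comp (Ideal.Quotient.mkₐ k m), ?_⟩
  ext a
  rw [RingHom.mem_ker]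
  change e.symm (Ideal.Quotient.mk m a) = 0 ↔ _
  rw [map_eq_zero_iff _ e.symm.injective, Ideal.Quotient.eq_zero_iff_mem]

lemma isUnit_of_forall_algHom_ne_zero [IsAlgClosed k] {a : A} (h : ∀ x : A →ₐ[k] k, x a ≠ 0) :
    IsUnit a := by
  by_contra hu
  obtain ⟨m, hm, ham⟩ := exists_max_ideal_of_mem_nonunits hu
  obtain ⟨x, hx⟩ := exists_algHom_ker_eq (k := k) m
  rw [← hx] at ham
  exact h x ham

lemma isNilpotent_of_forall_algHom_eq_zero [IsAlgClosed k] {a : A}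
    (h : ∀ x : A →ₐ[k] k, x a = 0) : IsNilpotent a := by
  have : IsJacobsonRing A := isJacobsonRing_of_finiteType (A := k)
  rw [← mem_nilradical, nilradical, Ideal.radical_eq_jacobson, Ideal.jacobson, Submodule.mem_sInf]
  rintro m ⟨_, hm⟩
  obtain ⟨x, hx⟩ := exists_algHom_ker_eq (k := k) m
  rw [← hx]
  exact h x

variable [Infinite k] {ka : A →ₐ[k] A[T;T⁻¹]}

/-- If the elements of negative weight are nilpotent, then the weights are bounded below. -/
lemma exists_weight_bound (hka : IsGmAction ka)
    (hneg : ∀ n < 0, ∀ a, IsWeight ka n a → IsNilpotent a) :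
    ∃ K : ℤ, ∀ n < K, ∀ a, IsWeight ka n a → a = 0 := by
  classical
  obtain ⟨s, hs⟩ := (Algebra.FiniteType.out : (⊤ : Subalgebra k A).FG)
  -- Homogeneous generators of `A`: the components of the elements of a finite generating set.
  let G : Finset A := s.biUnion fun a => (ka a).coeff.support.image (ka a).coeff
  have hG : ∀ g ∈ G, ∃ n, IsWeight ka n g := by
    intro g hg
    obtain ⟨a, _, hg⟩ := Finset.mem_biUnion.1 hg
    obtain ⟨n, _, rfl⟩ := Finset.mem_image.1 hg
    exact ⟨n, hka.isWeight_coeff a n⟩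
  have hGtop : Algebra.adjoin k (G : Set A) = ⊤ := by
    rw [eq_top_iff, ← hs, Algebra.adjoin_le_iff]
    intro a ha
    rw [SetLike.mem_coe, ← hka.sum_coeff a]
    refine Subalgebra.sum_mem _ fun n hn => Algebra.subset_adjoin ?_
    exact Finset.mem_biUnion.2 ⟨a, ha, Finset.mem_image_of_mem _ hn⟩
  choose! d hd using hG
  have hnil : ∀ g ∈ G, ∃ e : ℕ, d g < 0 → g ^ e = 0 := by
    intro g hg
    by_cases h : d g < 0
    · obtain ⟨e, he⟩ := hneg _ h g (hd g hg)
      exact ⟨e, fun _ => he⟩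
    · exact ⟨0, fun h' => absurd h' h⟩
  choose! e he using hnil
  -- A monomial containing a generator `g` of negative weight at least `e g` times is zero; the
  -- other monomials have weight at least this sum, since generators of nonnegative weight only
  -- raise it.
  refine ⟨∑ g ∈ G, min 0 (e g * d g), fun n hn a ha => ?_⟩
  rw [← ha.coeff_self]
  change weightProj ka n a = 0
  have hmem : a ∈ Submodule.span k (Submonoid.closure (G : Set A) : Set A) := by
    rw [← Algebra.adjoin_eq_span, hGtop]
    trivial
  suffices Submodule.span k (Submonoid.closure (G : Set A) : Set A) ≤
    LinearMap.ker (weightProj ka n) from this hmem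
  rw [Submodule.span_le]
  intro m hm
  obtain ⟨c, _, rfl⟩ := Submonoid.mem_closure_finset.1 hm
  rw [SetLike.mem_coe, LinearMap.mem_ker]
  by_cases hc : ∃ g ∈ G, d g < 0 ∧ e g ≤ c g
  · obtain ⟨g, hg, hdg, hcg⟩ := hc
    have h0 : ∏ g ∈ G, g ^ c g = 0 := by
      refine Finset.prod_eq_zero hg ?_
      rw [← Nat.sub_add_cancel hcg, pow_add, he g hg hdg, mul_zero]
    rw [h0, map_zero]
  · push Not at hc
    refine ((IsWeight.prod_pow hd c).coeff n).trans (if_neg ?_)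
    have hle : ∑ g ∈ G, min 0 (e g * d g) ≤ ∑ g ∈ G, c g * d g := by
      refine Finset.sum_le_sum fun g hg => ?_
      by_cases hdg : d g < 0
      · refine (min_le_right _ _).trans ?_
        have h1 : (c g : ℤ) ≤ e g := by exact_mod_cast (hc g hg hdg).le
        exact mul_le_mul_of_nonpos_right h1 hdg.le
      · exact (min_le_left _ _).trans (mul_nonneg (Int.natCast_nonneg _) (not_lt.1 hdg))
    omega

end FiniteType

/-! ### Slices for actions with limits and trivial stabilisers -/

section Slices

open TensorProduct

variable {k H A : Type*} [Field k] [IsAlgClosed k] [CharZero k] [CommRing H] [Algebra k H] [CommRing A]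
  [Algebra k A] [Algebra.FiniteType k A] {ct : H →ₐ[k] k} {cm : H →ₐ[k] H ⊗[k] H}
  {co : A →ₐ[k] H ⊗[k] A} {hco : IsCoaction ct cm co} {J : Type*} [Fintype J] [DecidableEq J]
  {p : J → pointDer ct} {w : J → ℤ} {ka : A →ₐ[k] A[T;T⁻¹]}

/-- For every homomorphism `x : A → k` the projection to weight zero defines a limit `z : A → k`,
the homomorphism `x` vanishes in negative weights, and the stabiliser of `z` has trivial Lie
algebra. -/
structure HasFreeLimits (ct : H →ₐ[k] k) (co : A →ₐ[k] H ⊗[k] A) (ka : A →ₐ[k] A[T;T⁻¹]) :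
    Prop where
  exists_limit : ∀ x : A →ₐ[k] k, ∃ z : A →ₐ[k] k, (∀ a, z a = x ((ka a).coeff 0)) ∧
    (∀ n < 0, ∀ a, x ((ka a).coeff n) = 0) ∧
    ∀ q ∈ pointDer ct, (∀ a, z (contract q A (co a)) = 0) → q = 0

lemma HasFreeLimits.apply_eq_zero (hl : HasFreeLimits ct co ka) (x : A →ₐ[k] k) {n : ℤ}
    (hn : n < 0) {a : A} (ha : IsWeight ka n a) : x a = 0 := by
  obtain ⟨_, _, h, _⟩ := hl.exists_limit x
  rw [← ha.coeff_self]
  exact h n hn a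

variable (ka) in
/-- The ideal generated by the homogeneous elements of nonzero weight. -/
def nonzeroWeightIdeal : Ideal A := Ideal.span {a | ∃ n ≠ 0, IsWeight ka n a}

/-- A proper submodule lies in a maximal one, whose quotient is simple, so it is the residue field
`k` of a point `x`. The numbers `c i` are the images of the standard basis vectors in it. -/
lemma exists_linear_functional_of_ne_top {Q : Submodule A (J → A)} (hQ : Q ≠ ⊤) :
    ∃ (x : A →ₐ[k] k) (c : J → k), c ≠ 0 ∧ ∀ v ∈ Q, ∑ i, c i * x (v i) = 0 := by
  obtain ⟨Q', hQ', hle⟩ := (eq_top_or_exists_le_coatom Q).resolve_left hQ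
  obtain ⟨m, hm, ⟨e⟩⟩ := isSimpleModule_iff_quot_maximal.1 (isSimpleModule_iff_isCoatom.2 hQ')
  obtain ⟨x, hx⟩ := exists_algHom_ker_eq (k := k) m
  choose b hb using fun i : J => Ideal.Quotient.mk_surjective (e (Q'.mkQ (Pi.single i 1)))
  have key : ∀ v : J → A, ∑ i, x (b i) * x (v i) = 0 ↔ v ∈ Q' := by
    intro v
    have h1 : e (Q'.mkQ v) = Ideal.Quotient.mk m (∑ i, b i * v i) := by
      rw [← Finset.univ_sum_single v, map_sum, map_sum, map_sum]
      refine Finset.sum_congr rfl fun i _ => ?_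
      rw [← mul_one (v i), ← smul_eq_mul, Pi.single_smul, map_smul, map_smul, ← hb, map_mul,
        Finset.univ_sum_single, Algebra.smul_def, mul_comm]
      rfl
    rw [← Submodule.Quotient.mk_eq_zero Q', ← Submodule.mkQ_apply, ← e.map_eq_zero_iff, h1,
      Ideal.Quotient.eq_zero_iff_mem, ← hx, RingHom.mem_ker, map_sum]
    simp only [map_mul]
  refine ⟨x, fun i => x (b i), fun h0 => hQ'.1 ?_, fun v hv => (key v).2 (hle hv)⟩
  rw [eq_top_iff]
  intro v _
  rw [← key]
  refine Finset.sum_eq_zero fun i _ => ?_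
  rw [show x (b i) = 0 from congrFun h0 i, zero_mul]

/-- Otherwise a nonzero functional `c` at a point `x` kills both summands. The second one forces `x`
to be its own limit; the first one makes `∑ c j • p j` a tangent vector of the stabiliser of that
limit, which is zero, against linear independence. -/
lemma span_rows_eq_top (hka : IsGmAction ka) (hl : HasFreeLimits ct co ka)
    (hli : LinearIndependent k fun j => (p j).1) :
    Submodule.span A (Set.range fun (a : A) (j : J) => coDer hco (p j) a) ⊔
      Submodule.pi Set.univ (fun _ : J => nonzeroWeightIdeal ka) = ⊤ := by
  by_contra hne
  obtain ⟨x, c, hc, h⟩ := exists_linear_functional_of_ne_top (k := k) hne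
  obtain ⟨z, hz, _, hq⟩ := hl.exists_limit x
  obtain ⟨i, hi⟩ := Function.ne_iff.1 hc
  -- Since `c i ≠ 0`, applying the functional to multiples of the `i`-th basis vector shows that `x`
  -- kills all components of nonzero weight; so `x` agrees with its limit `z`.
  have hxz : x = z := by
    ext a
    have h1 : ∀ n ∈ (ka a).coeff.support, x ((ka a).coeff n) =
        if n = 0 then x ((ka a).coeff 0) else 0 := by
      intro n _
      split_ifs with hn
      · rw [hn]
      · have h2 := h (Pi.single i ((ka a).coeff n)) (Submodule.mem_sup_right fun j _ => by
          by_cases hj : j = i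
          · subst hj
            rw [Pi.single_eq_same]
            exact Ideal.subset_span ⟨n, hn, hka.isWeight_coeff a n⟩
          · rw [Pi.single_eq_of_ne hj]
            exact Submodule.zero_mem _)
        rw [Finset.sum_eq_single i (fun j _ hj => by rw [Pi.single_eq_of_ne hj, map_zero, mul_zero])
          (fun hi => absurd (Finset.mem_univ i) hi), Pi.single_eq_same] at h2
        exact (mul_eq_zero.1 h2).resolve_left hi
    rw [hz]
    conv_lhs => rw [← hka.sum_coeff a, map_sum, Finset.sum_congr rfl h1, Finset.sum_ite_eq']
    split_ifs with h0
    · rfl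
    · rw [Finsupp.notMem_support_iff.1 h0, map_zero]
  have h0 : ∑ j, c j • (p j).1 = 0 := by
    refine hq _ (Submodule.sum_mem _ fun j _ => Submodule.smul_mem _ _ (p j).2) fun a => ?_
    rw [contract_sum, map_sum, ← hxz,
      ← h _ (Submodule.mem_sup_left (Submodule.subset_span ⟨a, rfl⟩))]
    refine Finset.sum_congr rfl fun j _ => ?_
    rw [map_smul, smul_eq_mul]
    rfl
  exact hi (Fintype.linearIndependent_iff.1 hli c h0 i)

lemma exists_weight_function (hka : IsGmAction ka) (hl : HasFreeLimits ct co ka)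
    (hli : LinearIndependent k fun j => (p j).1) (hw : ∀ j, 0 < w j)
    (hD : ∀ (j : J) (t : kˣ) a, coDer hco (p j) (laurentEval A t (ka a)) =
      ((t ^ w j : kˣ) : k) • laurentEval A t (ka (coDer hco (p j) a))) (j : J) :
    ∃ f : A, IsWeight ka (w j) f ∧ ∀ (x : A →ₐ[k] k) i, w i = w j →
      x (coDer hco (p i) f) = if i = j then 1 else 0 := by
  have hmem : (Pi.single j 1 : J → A) ∈
      Submodule.span A (Set.range fun (a : A) (j : J) => coDer hco (p j) a) ⊔
      Submodule.pi Set.univ (fun _ : J => nonzeroWeightIdeal ka) := by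
    rw [span_rows_eq_top hka hl hli]
    trivial
  obtain ⟨y, hy, v, hv, hyv⟩ := Submodule.mem_sup.1 hmem
  obtain ⟨c, rfl⟩ := Finsupp.mem_span_range_iff_exists_finsupp.1 hy
  -- The `j`-th basis vector is `∑ c b • (D_i b)_i` up to the ideal of nonzero weights. Weight zero
  -- parts of the coefficients and weight `w j` parts of the `b` give a function of weight `w j`. If
  -- `w i = w j`, the terms of its derivative in which `D_i` hits a coefficient have negative weight
  -- and vanish at `x`; the others take at `x` the values of `c b * D_i b` at the limit `z`.
  refine ⟨∑ b ∈ c.support, (ka (c b)).coeff 0 * (ka b).coeff (w j), IsWeight.sum fun b _ => ?_,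
    fun x i hij => ?_⟩
  · have := (hka.isWeight_coeff (c b) 0).mul (hka.isWeight_coeff b (w j))
    rwa [zero_add] at this
  · obtain ⟨z, hz, hx, _⟩ := hl.exists_limit x
    have hzv : z (v i) = 0 := by
      suffices nonzeroWeightIdeal ka ≤ RingHom.ker z from this (hv i trivial)
      rw [nonzeroWeightIdeal, Ideal.span_le]
      rintro a ⟨n, hn, ha⟩
      rw [SetLike.mem_coe, RingHom.mem_ker, hz, ha.coeff, if_neg hn, map_zero]
    have h1 := congrArg z (congrFun hyv i)
    rw [Pi.add_apply, map_add, hzv, add_zero, Finsupp.sum, Finset.sum_apply, map_sum] at h1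
    rw [map_sum, map_sum]
    refine Eq.trans (Finset.sum_congr rfl fun b _ => ?_) (h1.trans ?_)
    · rw [Derivation.leibniz, map_add, smul_eq_mul, smul_eq_mul, map_mul, map_mul,
        hl.apply_eq_zero x (n := 0 - w i) (by have := hw i; omega)
          ((hka.isWeight_coeff (c b) 0).derivation (hD i)), mul_zero, add_zero, Pi.smul_apply,
        smul_eq_mul, map_mul, hz, hz, coeff_derivation hka (hD i), zero_add, hij]
    · rw [Pi.single_apply]
      split_ifs <;> simp

/-- The entry `(i, j)` has weight `w j - w i`, so at each point it vanishes if `w j < w i`. Ordered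
by weight, the matrix is block triangular there with identity blocks, and its determinant takes the
value `1` at every point. -/
lemma isUnit_det_derMatrix (hl : HasFreeLimits ct co ka) {f : J → A}
    (hf : ∀ j, IsWeight ka (w j) (f j))
    (hD : ∀ (j : J) (t : kˣ) a, coDer hco (p j) (laurentEval A t (ka a)) =
      ((t ^ w j : kˣ) : k) • laurentEval A t (ka (coDer hco (p j) a)))
    (hfx : ∀ (x : A →ₐ[k] k) i j, w i = w j → x (coDer hco (p i) (f j)) = if i = j then 1 else 0) :
    IsUnit (derMatrix hco p f).det := by
  refine isUnit_of_forall_algHom_ne_zero (k := k) fun x => ?_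
  have h1 : (x.toRingHom.mapMatrix (derMatrix hco p f)).BlockTriangular w := by
    intro i j hij
    exact hl.apply_eq_zero x (n := w j - w i) (by omega) ((hf j).derivation (hD i))
  have h2 : x (derMatrix hco p f).det = 1 := by
    change x.toRingHom _ = 1
    rw [RingHom.map_det, h1.det]
    refine Finset.prod_eq_one fun a _ => ?_
    rw [← Matrix.det_one (n := {i // w i = a})]
    congr 1
    ext ⟨i, hi⟩ ⟨j, hj⟩
    rw [Matrix.one_apply]
    refine (hfx x i j (hi.trans hj.symm)).trans ?_
    simp only [Subtype.mk.injEq]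
  rw [h2]
  exact one_ne_zero

lemma isWeight_sliceDer {f : J → A} {W : Matrix J J A} (hf : ∀ j, IsWeight ka (w j) (f j))
    (hD : ∀ (j : J) (t : kˣ) a, coDer hco (p j) (laurentEval A t (ka a)) =
      ((t ^ w j : kˣ) : k) • laurentEval A t (ka (coDer hco (p j) a)))
    (hW : W * derMatrix hco p f = 1) {d : ℤ} {a : A} (ha : IsWeight ka d a) (j : J) :
    IsWeight ka (d - w j) (sliceDer hco p W j a) := by
  -- The failure of homogeneity of the slice derivatives of `a`. They solve a linear system with
  -- homogeneous data, so the image of the matrix of derivatives under `ka` kills `v`; that matrix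
  -- is invertible.
  let v : J → A[T;T⁻¹] := fun j => ka (sliceDer hco p W j a) -
    LaurentPolynomial.C (sliceDer hco p W j a) * LaurentPolynomial.T (d - w j)
  have h1 : ((derMatrix hco p f).map ka).mulVec v = 0 := by
    ext1 i
    have h2 : ka (coDer hco (p i) a) = ∑ j, ka (derMatrix hco p f i j) *
        ka (sliceDer hco p W j a) := by
      conv_lhs => rw [coDer_eq_sum hW, map_sum]
      simp only [map_mul]
    have h3 : ka (coDer hco (p i) a) = ∑ j, ka (derMatrix hco p f i j) *
        (LaurentPolynomial.C (sliceDer hco p W j a) * LaurentPolynomial.T (d - w j)) := by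
      rw [show ka (coDer hco (p i) a) = _ from ha.derivation (hD i)]
      conv_lhs => rw [coDer_eq_sum hW, map_sum, Finset.sum_mul]
      refine Finset.sum_congr rfl fun j _ => ?_
      have h4 : ka (derMatrix hco p f i j) = LaurentPolynomial.C (derMatrix hco p f i j) *
          LaurentPolynomial.T (w j - w i) := (hf j).derivation (hD i)
      rw [h4, show d - w i = (w j - w i) + (d - w j) by ring, LaurentPolynomial.T_add, map_mul]
      ring
    simp only [Matrix.mulVec, dotProduct, v, mul_sub, Finset.sum_sub_distrib, Matrix.map_apply]
    rw [← h2, ← h3, sub_self]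
    rfl
  have h5 : W.map ka * (derMatrix hco p f).map ka = 1 := by
    change W.map ka.toRingHom * (derMatrix hco p f).map ka.toRingHom = 1
    rw [← Matrix.map_mul, hW, Matrix.map_one _ (map_zero _) (map_one _)]
  have h6 : v = 0 := by
    rw [← Matrix.one_mulVec v, ← h5, ← Matrix.mulVec_mulVec, h1, Matrix.mulVec_zero]
  exact sub_eq_zero.1 (congrFun h6 j)

/-- An action with free limits of a group with a basis of its Lie algebra of positive weights
admits functions with an invertible matrix of derivatives, and the corresponding derivations are
locally nilpotent. -/
theorem exists_slices (hka : IsGmAction ka) (hl : HasFreeLimits ct co ka)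
    (hli : LinearIndependent k fun j => (p j).1) (hw : ∀ j, 0 < w j)
    (hD : ∀ (j : J) (t : kˣ) a, coDer hco (p j) (laurentEval A t (ka a)) =
      ((t ^ w j : kˣ) : k) • laurentEval A t (ka (coDer hco (p j) a))) :
    ∃ (f : J → A) (W : Matrix J J A), W * derMatrix hco p f = 1 ∧
      ∀ j a, ∃ N, (sliceDer hco p W j)^[N] a = 0 := by
  choose f hf hfx using exists_weight_function (hco := hco) hka hl hli hw hD
  have hu := isUnit_det_derMatrix hl hf hD fun x i j h => hfx j x i h
  have hW : (derMatrix hco p f)⁻¹ * derMatrix hco p f = 1 := Matrix.nonsing_inv_mul _ hu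
  obtain ⟨K, hK⟩ := exists_weight_bound hka fun n hn a ha =>
    isNilpotent_of_forall_algHom_eq_zero (k := k) fun x => hl.apply_eq_zero x hn ha
  refine ⟨f, _, hW, fun j a => ?_⟩
  change a ∈ nilSubalgebra k (sliceDer hco p (derMatrix hco p f)⁻¹ j)
  rw [← hka.sum_coeff a]
  refine Subalgebra.sum_mem _ fun n _ => ?_
  have hit : ∀ (N : ℕ) (b : A) (d : ℤ), IsWeight ka d b →
      IsWeight ka (d - N * w j) ((sliceDer hco p (derMatrix hco p f)⁻¹ j)^[N] b) := by
    intro N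
    induction N with
    | zero => intro b d hb; simpa using hb
    | succ N ih =>
      intro b d hb
      have := ih _ _ (isWeight_sliceDer hf hD hW hb j)
      rw [Function.iterate_succ_apply]
      convert this using 1
      push_cast
      ring
  -- Each step lowers the weight by `w j ≥ 1`, so this many steps bring it from `n` to below the
  -- bound `K`.
  refine ⟨(n - K).toNat + 1, hK _ ?_ _ (hit _ _ n (hka.isWeight_coeff a n))⟩
  have h1 : n - K ≤ (n - K).toNat := Int.self_le_toNat _
  have h2 := hw j
  push_cast
  nlinarith

end Slices

/-! ### Points of affine schemes as homomorphisms on functions -/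

section Coordinates

variable {k : Type u} [Field k]

/-- The `k`-algebra of global functions of a `k`-scheme. -/
def Functions (X : Sch k) : Type u := Γ(X.left, ⊤)

noncomputable instance (X : Sch k) : CommRing (Functions X) :=
  inferInstanceAs (CommRing Γ(X.left, ⊤))

noncomputable instance (X : Sch k) : Algebra k (Functions X) := (structureMap X).toAlgebra

/-- Pullback of functions along a morphism. -/
noncomputable def pull {X Y : Sch k} (φ : X ⟶ Y) : Functions Y →ₐ[k] Functions X :=
  { φ.left.appTop.hom with
    commutes' := fun a => RingHom.congr_fun (comp_structureMap φ) a }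

lemma pull_id (X : Sch k) : pull (𝟙 X) = AlgHom.id k _ := by
  ext a
  rfl

lemma pull_comp {X Y Z : Sch k} (φ : X ⟶ Y) (ψ : Y ⟶ Z) :
    pull (φ ≫ ψ) = (pull φ).comp (pull ψ) := by
  ext a
  rfl

variable {R S A : Type u} [CommRing R] [Algebra k R] [CommRing S] [Algebra k S]
  [CommRing A] [Algebra k A]

lemma specMap_id : specMap (AlgHom.id k R) = 𝟙 _ := by
  ext1
  exact Spec.map_id _

lemma specMap_comp (f : R →ₐ[k] S) (g : S →ₐ[k] A) :
    specMap (g.comp f) = specMap g ≫ specMap f := by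
  ext1
  exact Spec.map_comp (CommRingCat.ofHom f.toRingHom) (CommRingCat.ofHom g.toRingHom)

variable (k R) in
/-- The functions of `Spec R`. -/
noncomputable def specFunctions : Functions (specOver k R) ≃ₐ[k] R :=
  AlgEquiv.ofRingEquiv (f := (Scheme.ΓSpecIso (CommRingCat.of R)).commRingCatIsoToRingEquiv) (by
    intro a
    change (Scheme.ΓSpecIso (CommRingCat.of R)).hom.hom ((Spec.map (CommRingCat.ofHom
      (algebraMap k R))).appTop.hom ((Scheme.ΓSpecIso (CommRingCat.of k)).inv.hom a)) = _
    have h := Scheme.ΓSpecIso_naturality (CommRingCat.ofHom (algebraMap k R))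
    have h2 := congrArg (fun φ => φ.hom ((Scheme.ΓSpecIso (CommRingCat.of k)).inv.hom a)) h
    refine h2.trans ?_
    change algebraMap k R (((Scheme.ΓSpecIso (CommRingCat.of k)).inv ≫
      (Scheme.ΓSpecIso (CommRingCat.of k)).hom).hom a) = _
    rw [Iso.inv_hom_id]
    rfl)

/-- The homomorphism on functions that an `R`-valued point of `X` gives. -/
noncomputable def coord {X : Sch k} (φ : specOver k R ⟶ X) : Functions X →ₐ[k] R :=
  (specFunctions k R).toAlgHom.comp (pull φ)

lemma specFunctions_pull (f : R →ₐ[k] S) (a : Functions (specOver k R)) :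
    specFunctions k S (pull (specMap f) a) = f (specFunctions k R a) := by
  have h := Scheme.ΓSpecIso_naturality (CommRingCat.ofHom f.toRingHom)
  exact congrArg (fun φ => φ.hom a) h

lemma coord_specMap_comp {X : Sch k} (f : R →ₐ[k] S) (φ : specOver k R ⟶ X) :
    coord (specMap f ≫ φ) = f.comp (coord φ) := by
  ext a
  simp only [coord, pull_comp, AlgHom.comp_apply]
  exact specFunctions_pull f _

lemma coord_comp {X Y : Sch k} (φ : specOver k R ⟶ X) (ψ : X ⟶ Y) :
    coord (φ ≫ ψ) = (coord φ).comp (pull ψ) := by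
  ext a
  simp only [coord, pull_comp, AlgHom.comp_apply]

/-- The canonical morphism from `X` to the spectrum of its functions. -/
noncomputable def toSpecFunctions (X : Sch k) : X ⟶ specOver k (Functions X) :=
  Over.homMk X.left.toSpecΓ (by
    change X.left.toSpecΓ ≫ Spec.map ((Scheme.ΓSpecIso (CommRingCat.of k)).inv ≫ X.hom.appTop) = _
    have h' := Scheme.toSpecΓ_naturality X.hom
    rw [Spec.map_comp, ← Category.assoc]
    refine (congrArg (· ≫ Spec.map (Scheme.ΓSpecIso (CommRingCat.of k)).inv) h'.symm).trans ?_
    rw [Category.assoc]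
    erw [toSpecΓ_SpecMap_ΓSpecIso_inv]
    exact Category.comp_id _)

lemma pull_toSpecFunctions (X : Sch k) :
    pull (toSpecFunctions X) = (specFunctions k (Functions X)).toAlgHom := by
  ext a
  change (X.left.toSpecΓ.appTop).hom a = (Scheme.ΓSpecIso _).hom.hom a
  rw [Scheme.toSpecΓ_appTop]
  rfl

instance isIso_toSpecFunctions (X : Sch k) [IsAffine X.left] : IsIso (toSpecFunctions X) := by
  have : IsIso ((Over.forget _).map (toSpecFunctions X)) :=
    inferInstanceAs (IsIso X.left.toSpecΓ)
  exact isIso_of_reflects_iso _ (Over.forget _)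

variable {X : Sch k} [IsAffine X.left]

/-- The `R`-valued point of an affine scheme given by a homomorphism on functions. -/
noncomputable def ofCoord (f : Functions X →ₐ[k] R) : specOver k R ⟶ X :=
  specMap f ≫ inv (toSpecFunctions X)

lemma coord_inv_toSpecFunctions :
    coord (inv (toSpecFunctions X)) = AlgHom.id k (Functions X) := by
  have h : (pull (inv (toSpecFunctions X))).comp (pull (toSpecFunctions X)) = AlgHom.id k _ := by
    rw [← pull_comp, IsIso.inv_hom_id, pull_id]
  ext a
  obtain ⟨b, rfl⟩ := (specFunctions k (Functions X)).surjective a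
  have h1 := AlgHom.congr_fun h b
  rw [pull_toSpecFunctions] at h1
  exact congrArg (specFunctions k (Functions X)) h1

lemma coord_ofCoord (f : Functions X →ₐ[k] R) : coord (ofCoord f) = f := by
  rw [ofCoord, coord_specMap_comp, coord_inv_toSpecFunctions, AlgHom.comp_id]

lemma coord_injective : Function.Injective (coord : (specOver k R ⟶ X) → _) := by
  intro φ ψ h
  ext1
  apply ext_of_isAffine
  ext a
  have := AlgHom.congr_fun h a
  exact (specFunctions k R).injective this

lemma ofCoord_coord (φ : specOver k R ⟶ X) : ofCoord (coord φ) = φ :=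
  coord_injective (coord_ofCoord _)

lemma specMap_ofCoord (f : R →ₐ[k] S) (g : Functions X →ₐ[k] R) :
    specMap f ≫ ofCoord g = ofCoord (f.comp g) := by
  rw [ofCoord, ofCoord, specMap_comp, Category.assoc]

lemma coord_specMap (f : R →ₐ[k] S) :
    coord (specMap f) = f.comp (specFunctions k R).toAlgHom := by
  ext a
  exact specFunctions_pull f a

lemma isIso_of_bijective_coord (φ : specOver k R ⟶ X) (h : Function.Bijective (coord φ)) :
    IsIso φ := by
  let e := AlgEquiv.ofBijective (coord φ) h
  have h1 : IsIso (specMap (coord φ)) := by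
    refine ⟨specMap e.symm.toAlgHom, ?_, ?_⟩
    · rw [← specMap_comp, ← specMap_id]
      congr 1
      ext a
      exact e.apply_symm_apply a
    · rw [← specMap_comp, ← specMap_id]
      congr 1
      ext a
      exact e.symm_apply_apply a
  rw [← ofCoord_coord φ, ofCoord]
  infer_instance

end Coordinates

/-! ### Group schemes and actions in terms of functions -/

section Coactions

open scoped TensorProduct

variable {k : Type u} [Field k]

section Pairs

variable {X Y Z : Sch k} [IsAffine X.left] [IsAffine Y.left]
  {R : Type u} [CommRing R] [Algebra k R]

variable (X Y) in
/-- The universal pair of points of two affine schemes. -/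
noncomputable def universalPair : specOver k (Functions X ⊗[k] Functions Y) ⟶ X ⊗ Y :=
  lift (ofCoord Algebra.TensorProduct.includeLeft) (ofCoord Algebra.TensorProduct.includeRight)

lemma specMap_productMap_universalPair (x : specOver k R ⟶ X) (y : specOver k R ⟶ Y) :
    specMap (Algebra.TensorProduct.productMap (coord x) (coord y)) ≫ universalPair X Y =
      lift x y := by
  rw [universalPair, comp_lift, specMap_ofCoord, specMap_ofCoord,
    Algebra.TensorProduct.productMap_left, Algebra.TensorProduct.productMap_right,
    ofCoord_coord, ofCoord_coord]

lemma coord_lift_comp (m : X ⊗ Y ⟶ Z) (x : specOver k R ⟶ X) (y : specOver k R ⟶ Y) :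
    coord (lift x y ≫ m) =
      (Algebra.TensorProduct.productMap (coord x) (coord y)).comp
        (coord (universalPair X Y ≫ m)) := by
  rw [← coord_specMap_comp, ← Category.assoc, specMap_productMap_universalPair]

lemma productMap_lTensor_eq {B C D : Type u} [CommRing B] [Algebra k B] [CommRing C] [Algebra k C]
    [CommRing D] [Algebra k D] (f : B →ₐ[k] C) (h : D ⊗[k] B) :
    Algebra.TensorProduct.productMap (Algebra.TensorProduct.includeLeft : D →ₐ[k] D ⊗[k] C)
      (Algebra.TensorProduct.includeRight.comp f) h = f.toLinearMap.lTensor D h := by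
  induction h with
  | zero => simp
  | add x y hx hy => rw [map_add, map_add, hx, hy]
  | tmul x y => simp

end Pairs

lemma lift_actionVia {H G X T : Sch k} [GrpObj H] [GrpObj G] [ModObj G X] (incl : H ⟶ G) (u : T ⟶ H) (x : T ⟶ X) :
    lift u x ≫ actionVia X incl = (u ≫ incl) • x := by
  rw [actionVia, lift_whiskerRight_assoc, Hom.smul_def]

variable {U G X : Sch k} [GrpObj U] [GrpObj G] [ModObj G X] [IsAffine U.left] [IsAffine X.left]
  {R : Type u} [CommRing R] [Algebra k R]

variable (U) in
/-- The comultiplication on the functions of an affine group scheme. -/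
noncomputable def comulHom : Functions U →ₐ[k] Functions U ⊗[k] Functions U :=
  coord (universalPair U U ≫ μ[U])

variable (U) in
/-- The counit on the functions of a group scheme. -/
noncomputable def counitHom : Functions U →ₐ[k] k :=
  coord (1 : specOver k k ⟶ U)

variable (X) in
/-- The coaction on functions given by an action through a homomorphism. -/
noncomputable def coactionHom (incl : U ⟶ G) : Functions X →ₐ[k] Functions U ⊗[k] Functions X :=
  coord (universalPair U X ≫ actionVia X incl)

lemma coord_mul (u v : specOver k R ⟶ U) :
    coord (u * v) =
      (Algebra.TensorProduct.productMap (coord u) (coord v)).comp (comulHom U) := by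
  rw [Hom.mul_def, coord_lift_comp, comulHom]

lemma coord_one : coord (1 : specOver k R ⟶ U) = (Algebra.ofId k R).comp (counitHom U) := by
  rw [counitHom, ← coord_specMap_comp, MonObj.comp_one]

lemma coord_smul (incl : U ⟶ G) (u : specOver k R ⟶ U) (x : specOver k R ⟶ X) :
    coord ((u ≫ incl) • x) =
      (Algebra.TensorProduct.productMap (coord u) (coord x)).comp (coactionHom X incl) := by
  rw [← lift_actionVia, coord_lift_comp, coactionHom]

lemma isCoaction_coactionHom (incl : U ⟶ G) [IsMonHom incl] :
    IsCoaction (counitHom U) (comulHom U) (coactionHom X incl) where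
  coassoc a := by
    -- The universal points of `U`, `U` and `X`: the associativity law of the action, applied to
    -- them and read on functions, is coassociativity.
    let u₁ : specOver k (Functions U ⊗[k] (Functions U ⊗[k] Functions X)) ⟶ U :=
      ofCoord Algebra.TensorProduct.includeLeft
    let u₂ : specOver k (Functions U ⊗[k] (Functions U ⊗[k] Functions X)) ⟶ U :=
      ofCoord (Algebra.TensorProduct.includeRight.comp Algebra.TensorProduct.includeLeft)
    let x : specOver k (Functions U ⊗[k] (Functions U ⊗[k] Functions X)) ⟶ X :=
      ofCoord (Algebra.TensorProduct.includeRight.comp Algebra.TensorProduct.includeRight)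
    have h : ((u₁ * u₂) ≫ incl) • x = (u₁ ≫ incl) • ((u₂ ≫ incl) • x) := by
      rw [MonObj.mul_comp, mul_smul]
    have h2 := congrArg coord h
    rw [coord_smul, coord_smul, coord_smul, coord_mul] at h2
    simp only [u₁, u₂, x, coord_ofCoord] at h2
    have h3 := AlgHom.congr_fun h2 a
    have hr : Algebra.TensorProduct.productMap
        ((Algebra.TensorProduct.includeRight :
          Functions U ⊗[k] Functions X →ₐ[k] Functions U ⊗[k] (Functions U ⊗[k] Functions X)).comp
          Algebra.TensorProduct.includeLeft)
        (Algebra.TensorProduct.includeRight.comp Algebra.TensorProduct.includeRight) =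
        Algebra.TensorProduct.includeRight := by
      ext <;> simp
    rw [hr] at h3
    simp only [AlgHom.comp_apply] at h3
    rw [productMap_lTensor_eq] at h3
    rw [← h3]
    generalize coactionHom X incl a = b
    induction b with
    | zero => simp
    | add x y hx hy => simp only [map_add, hx, hy]
    | tmul g a =>
      simp only [LinearMap.rTensor_tmul, AlgHom.toLinearMap_apply,
        Algebra.TensorProduct.productMap_apply_tmul, AlgHom.comp_apply]
      generalize comulHom U g = c
      induction c with
      | zero => simp
      | add x y hx hy => simp only [map_add, TensorProduct.add_tmul, hx, hy, add_mul]
      | tmul g h => simp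
  counit a := by
    let x : specOver k (Functions X) ⟶ X := ofCoord (AlgHom.id k _)
    have h : ((1 : specOver k (Functions X) ⟶ U) ≫ incl) • x = x := by
      rw [MonObj.one_comp, one_smul]
    have h2 := congrArg coord h
    rw [coord_smul, coord_one] at h2
    simp only [x, coord_ofCoord] at h2
    have h3 := AlgHom.congr_fun h2 a
    simp only [AlgHom.comp_apply, AlgHom.id_apply] at h3
    refine Eq.trans ?_ h3
    generalize coactionHom X incl a = b
    induction b with
    | zero => simp
    | add x y hx hy => simp only [map_add, hx, hy]
    | tmul g a => simp [contract_tmul, Algebra.smul_def, Algebra.ofId_apply]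

lemma isCoaction_comulHom : IsCoaction (counitHom U) (comulHom U) (comulHom U) := by
  -- The comultiplication is the coaction of the action of `U` on itself by left multiplication.
  let _ : ModObj U U := ModObj.regular U
  have h : coactionHom U (𝟙 U) = comulHom U := by
    rw [coactionHom, comulHom, actionVia, id_whiskerRight, Category.id_comp]
    rfl
  have h2 := isCoaction_coactionHom (X := U) (𝟙 U)
  rwa [h] at h2

lemma rid_lTensor_counitHom (g : Functions U) :
    TensorProduct.rid k (Functions U)
      ((counitHom U).toLinearMap.lTensor (Functions U) (comulHom U g)) = g := by
  let u : specOver k (Functions U) ⟶ U := ofCoord (AlgHom.id k _)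
  have h2 := congrArg coord (mul_one u)
  rw [coord_mul, coord_one] at h2
  simp only [u, coord_ofCoord] at h2
  have h3 := AlgHom.congr_fun h2 g
  simp only [AlgHom.comp_apply, AlgHom.id_apply] at h3
  refine Eq.trans ?_ h3
  generalize comulHom U g = b
  induction b with
  | zero => simp
  | add x y hx hy => simp only [map_add, hx, hy]
  | tmul g a => simp [Algebra.smul_def, Algebra.ofId_apply, mul_comm]

end Coactions

/-! ### Functions on a unipotent group scheme -/

section Unipotent

open scoped TensorProduct

variable {k : Type u} [Field k] {U : Sch k}

lemma finiteType_functions (X : Sch k) [IsAffine X.left] [LocallyOfFiniteType X.hom] :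
    Algebra.FiniteType k (Functions X) := by
  have h : X.hom.appTop.hom.FiniteType :=
    HasRingHomProperty.appTop (P := @LocallyOfFiniteType) X.hom inferInstance
  exact RingHom.FiniteType.comp h (RingHom.FiniteType.of_surjective _
    (Scheme.ΓSpecIso (CommRingCat.of k)).symm.commRingCatIsoToRingEquiv.surjective)

/-- On functions, a closed immersion into affine space is a surjection from the polynomial ring, and
it sends the variables to `v`. -/
lemma adjoin_eq_top_of_isClosedImmersion {κ : Type u} (v : κ → Γ(U.left, ⊤))
    [h : IsClosedImmersion (AffineSpace.homOfVector U.hom v)] :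
    Algebra.adjoin k (A := Functions U) (Set.range v) = ⊤ := by
  have h1 := (IsClosedImmersion.isAffine_surjective_of_isAffine
    (AffineSpace.homOfVector U.hom v ≫ (AffineSpace.SpecIso κ (CommRingCat.of k)).hom)).2
  have h2 : (MvPolynomial.aeval (R := k) (S₁ := Functions U) v).toRingHom =
      ((Scheme.ΓSpecIso (CommRingCat.of (MvPolynomial κ k))).inv ≫
        (AffineSpace.homOfVector U.hom v ≫
          (AffineSpace.SpecIso κ (CommRingCat.of k)).hom).appTop).hom := by
    rw [Scheme.Hom.comp_appTop]
    rw [AffineSpace.SpecIso_hom_appTop]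
    simp only [Category.assoc, Iso.inv_hom_id_assoc]
    apply MvPolynomial.ringHom_ext
    · intro a
      have := congrArg (fun φ => φ.appTop.hom ((Scheme.ΓSpecIso (CommRingCat.of k)).inv.hom a))
        (AffineSpace.homOfVector_over U.hom v)
      refine (AlgHom.commutes _ a).trans (this.symm.trans ?_)
      rw [Scheme.Hom.comp_appTop]
      exact congrArg (AffineSpace.homOfVector U.hom v).appTop.hom
        (MvPolynomial.eval₂Hom_C
          ((Scheme.ΓSpecIso (CommRingCat.of k)).inv ≫
            (𝔸(κ; Spec (CommRingCat.of k)) ↘ Spec (CommRingCat.of k)).appTop).hom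
          (AffineSpace.coord (Spec (CommRingCat.of k))) a).symm
    · intro i
      have := AffineSpace.homOfVector_appTop_coord U.hom v i
      simp only [CommRingCat.hom_comp]
      exact (MvPolynomial.aeval_X _ i).trans
        (this.symm.trans (congrArg _ (MvPolynomial.eval₂Hom_X' _ _ i).symm))
  have h3 : Function.Surjective (MvPolynomial.aeval (R := k) (S₁ := Functions U) v) := by
    have : Function.Surjective
        (MvPolynomial.aeval (R := k) (S₁ := Functions U) v).toRingHom := by
      rw [h2]
      exact h1.comp (Scheme.ΓSpecIso
        (CommRingCat.of (MvPolynomial κ k))).symm.commRingCatIsoToRingEquiv.surjective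
    exact this
  exact (Algebra.adjoin_range_eq_range_aeval k (S₁ := Functions U) v).trans <| (AlgHom.range_eq_top _).2 h3

variable [GrpObj U]

lemma IsUnipotent.isAffine (hU : IsUnipotent U) : IsAffine U.left := by
  obtain ⟨n, M, -, -, -, h⟩ := hU
  exact (IsClosedImmersion.isAffine_surjective_of_isAffine
    (AffineSpace.homOfVector U.hom fun p : ULift.{u} (Fin n × Fin n) =>
      M p.down.1 p.down.2)).1

lemma IsUnipotent.exists_isUnitriangular [IsAffine U.left] (hU : IsUnipotent U) :
    ∃ (n : ℕ) (M : Matrix (Fin n) (Fin n) (Functions U)),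
      IsUnitriangular k (counitHom U) (comulHom U) M := by
  obtain ⟨n, M, hd, hl, hm, h⟩ := hU
  have hmul : ∀ {R : Type u} [CommRing R] [Algebra k R] (g h : specOver k R ⟶ U) (i j),
      coord (g * h) (M i j) = ∑ l, coord g (M i l) * coord h (M l j) := by
    intro R _ _ g h i j
    have h1 := congrFun (congrFun (hm _ g h) i) j
    have h2 := congrArg (specFunctions k R) h1
    rw [Matrix.mul_apply] at h2
    refine h2.trans ((map_sum (specFunctions k R) _ _).trans ?_)
    exact Finset.sum_congr rfl fun l _ => map_mul (specFunctions k R) _ _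
  have hmt (a b : Functions U) : (Algebra.TensorProduct.includeLeft :
      Functions U →ₐ[k] Functions U ⊗[k] Functions U) a *
        (Algebra.TensorProduct.includeRight :
      Functions U →ₐ[k] Functions U ⊗[k] Functions U) b = a ⊗ₜ b := by simp
  refine ⟨n, M, hd, hl, fun i j => ?_, fun i j => ?_, ?_⟩
  · have h1 := hmul (ofCoord (Algebra.TensorProduct.includeLeft :
      Functions U →ₐ[k] Functions U ⊗[k] Functions U))
      (ofCoord Algebra.TensorProduct.includeRight) i j
    rw [Hom.mul_def] at h1
    refine h1.trans (Finset.sum_congr rfl fun l _ => ?_)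
    rw [coord_ofCoord, coord_ofCoord]
    exact hmt _ _
  -- Multiplicativity makes the value of `M` at the identity idempotent only; being unitriangular it
  -- is also invertible, hence equal to `1`.
  · let E : Matrix (Fin n) (Fin n) k := Matrix.of fun i j => counitHom U (M i j)
    have hE : E * E = E := by
      ext i j
      have h1 := hmul (1 : specOver k k ⟶ U) 1 i j
      rw [mul_one] at h1
      rw [Matrix.mul_apply]
      exact h1.symm
    have hdet : E.det = 1 := by
      rw [Matrix.det_of_isUpperTriangular]
      · refine Finset.prod_eq_one fun i _ => ?_
        change counitHom U (M i i) = 1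
        rw [hd]
        exact map_one (counitHom U)
      · intro i j hij
        change counitHom U (M i j) = 0
        rw [hl i j hij]
        exact map_zero (counitHom U)
    have hE1 : E = 1 := by
      have hu : IsUnit E := (Matrix.isUnit_iff_isUnit_det E).2 (hdet ▸ isUnit_one)
      exact hu.mul_left_cancel (by rw [hE, mul_one])
    have := congrFun (congrFun hE1 i) j
    rw [Matrix.one_apply] at this
    exact this
  · have h1 := adjoin_eq_top_of_isClosedImmersion (U := U)
      (fun p : ULift.{u} (Fin n × Fin n) => M p.down.1 p.down.2)
    rw [← h1]
    congr 1
    ext a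
    exact ⟨fun ⟨p, hp⟩ => ⟨⟨p⟩, hp⟩, fun ⟨p, hp⟩ => ⟨p.down, hp⟩⟩

end Unipotent

/-! ### The multiplicative group and its coaction -/

section Torus

open scoped TensorProduct

variable {k : Type u} [Field k] {R S A : Type u} [CommRing R] [Algebra k R] [CommRing S]
  [Algebra k S] [CommRing A] [Algebra k A]

lemma specPoint_eq (f : A →ₐ[k] k) :
    specPoint f = specPoint (AlgHom.id k k) ≫ specMap f := by
  ext1
  change Spec.map _ = Spec.map _ ≫ Spec.map _
  rw [← Spec.map_comp]
  rfl

lemma toUnit_specPoint (f : A →ₐ[k] k) :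
    toUnit (specOver k R) ≫ specPoint f = specMap ((Algebra.ofId k R).comp f) := by
  have h2 : toUnit (specOver k R) ≫ specPoint (AlgHom.id k k) = specMap (Algebra.ofId k R) := by
    have h3 : specPoint (AlgHom.id k k) ≫ toUnit (specOver k k) = 𝟙 _ := toUnit_unique _ _
    have h4 : toUnit (specOver k k) ≫ specPoint (AlgHom.id k k) = 𝟙 _ := by
      have h5 : Spec.map (CommRingCat.ofHom (RingHom.id k)) = 𝟙 (Spec (CommRingCat.of k)) :=
        Spec.map_id _
      ext1
      change Spec.map (CommRingCat.ofHom (RingHom.id k)) ≫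
        Spec.map (CommRingCat.ofHom (RingHom.id k)) = 𝟙 (Spec (CommRingCat.of k))
      rw [h5, Category.comp_id]
    rw [← Category.comp_id (specMap _), ← h4, ← Category.assoc]
    congr 1
    exact toUnit_unique _ _
  rw [specPoint_eq, ← Category.assoc, h2, ← specMap_comp]

lemma laurent_algHom_ext {f g : k[T;T⁻¹] →ₐ[k] R}
    (h : ∀ n, f (LaurentPolynomial.T n) = g (LaurentPolynomial.T n)) : f = g := by
  refine AlgHom.ext fun p => ?_
  induction p using LaurentPolynomial.induction_on' with
  | add p q hp hq => rw [map_add, map_add, hp, hq]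
  | C_mul_T n a =>
    rw [map_mul, map_mul, h]
    congr 1
    exact (f.commutes a).trans (g.commutes a).symm

/-- Evaluation of Laurent polynomials at `t`. -/
noncomputable def gmEval (t : kˣ) : k[T;T⁻¹] →ₐ[k] k :=
  { LaurentPolynomial.eval₂ (RingHom.id k) t with
    commutes' := fun a => LaurentPolynomial.eval₂_C (RingHom.id k) t a }

lemma gmEval_T (t : kˣ) (n : ℤ) : gmEval t (LaurentPolynomial.T n) = ((t ^ n : kˣ) : k) :=
  LaurentPolynomial.eval₂_T _ _ n

lemma specMap_mul (f g : k[T;T⁻¹] →ₐ[k] R) {h : k[T;T⁻¹] →ₐ[k] R}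
    (hh : ∀ n, h (LaurentPolynomial.T n) =
      f (LaurentPolynomial.T n) * g (LaurentPolynomial.T n)) :
    specMap f * specMap g = (specMap h : _ ⟶ Gm k) := by
  refine (map_mul (Spec.mapMulEquiv (R := k) (S := k[T;T⁻¹]) (T := R))
    (WithConv.toConv f) (WithConv.toConv g)).symm.trans ?_
  refine congrArg specMap ?_
  refine laurent_algHom_ext fun n => ?_
  rw [hh]
  refine (AlgHom.convMul_apply _ _ _).trans ?_
  rw [LaurentPolynomial.comul_T]
  rfl

lemma specMap_one {h : k[T;T⁻¹] →ₐ[k] R} (hh : ∀ n, h (LaurentPolynomial.T n) = 1) :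
    (specMap h : _ ⟶ Gm k) = 1 := by
  have h1 : (specMap h : _ ⟶ Gm k) * specMap h = specMap h :=
    specMap_mul _ _ fun n => by rw [hh, mul_one]
  simpa using h1

/-- The constant point `t` of `𝔾ₘ`. -/
noncomputable def constGm (T : Sch k) (t : kˣ) : T ⟶ Gm k := toUnit T ≫ gmPoint t

lemma comp_constGm {T T' : Sch k} (φ : T' ⟶ T) (t : kˣ) :
    φ ≫ constGm T t = constGm T' t := by
  rw [constGm, ← Category.assoc, constGm]
  congr 1
  exact toUnit_unique _ _

lemma constGm_spec (t : kˣ) :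
    constGm (specOver k R) t = specMap ((Algebra.ofId k R).comp (gmEval t)) :=
  toUnit_specPoint _

lemma constGm_mul (s t : kˣ) :
    constGm (specOver k R) s * constGm (specOver k R) t = constGm (specOver k R) (s * t) := by
  rw [constGm_spec, constGm_spec, constGm_spec]
  refine specMap_mul _ _ fun n => ?_
  simp only [AlgHom.comp_apply, gmEval_T, mul_zpow, Units.val_mul, map_mul]

lemma constGm_one : constGm (specOver k R) 1 = 1 := by
  rw [constGm_spec]
  refine specMap_one fun n => ?_
  simp only [AlgHom.comp_apply, gmEval_T, one_zpow, Units.val_one, map_one]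

variable {G X : Sch k} [GrpObj G] [ModObj G X] [IsAffine X.left]

variable (A) in
/-- The tautological point of `𝔾ₘ` over `A[T, T⁻¹]`. -/
noncomputable def tautGm : specOver k A[T;T⁻¹] ⟶ Gm k :=
  specMap (AddMonoidAlgebra.mapAlgHom ℤ (Algebra.ofId k A))

variable (k A) in
/-- The constants in a ring of Laurent polynomials. -/
noncomputable def laurentC : A →ₐ[k] A[T;T⁻¹] := IsScalarTower.toAlgHom k A A[T;T⁻¹]

variable (X) in
/-- The coaction of the functions on `𝔾ₘ` on the functions on a scheme with action of `𝔾ₘ`. -/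
noncomputable def gmCoaction (lam : Gm k ⟶ G) : Functions X →ₐ[k] (Functions X)[T;T⁻¹] :=
  coord ((tautGm (Functions X) ≫ lam) • (ofCoord (laurentC k (Functions X)) : _ ⟶ X))

variable (X) in
/-- Translation of functions by the element `t` of `𝔾ₘ`. -/
noncomputable def translate (lam : Gm k ⟶ G) (t : kˣ) : Functions X →ₐ[k] Functions X :=
  coord ((constGm (specOver k (Functions X)) t ≫ lam) • (ofCoord (AlgHom.id k (Functions X)) : _ ⟶ X))

/-- The coaction is the universal point of `𝔾ₘ` acting on the universal point of `X`; a pair of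
`R`-valued points is their pullback along `h`. -/
lemma coord_gm_smul (lam : Gm k ⟶ G) (f : Functions X →ₐ[k] R) (h : (Functions X)[T;T⁻¹] →ₐ[k] R)
    (hf : h.comp (laurentC k _) = f) (t : k[T;T⁻¹] →ₐ[k] R)
    (ht : ∀ n, t (LaurentPolynomial.T n) = h (LaurentPolynomial.T n)) :
    coord ((specMap t ≫ lam) • (ofCoord f : _ ⟶ X)) = h.comp (gmCoaction X lam) := by
  rw [gmCoaction, ← coord_specMap_comp, ModObj.comp_smul, specMap_ofCoord, hf, tautGm,
    ← Category.assoc, ← specMap_comp]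
  congr 4
  refine laurent_algHom_ext fun n => ?_
  rw [ht]
  exact congrArg h ((AddMonoidAlgebra.mapRingHom_single _ _ _).trans (by rw [map_one]; rfl)).symm

lemma laurentEval_comp_gmCoaction (lam : Gm k ⟶ G) (t : kˣ) :
    (laurentEval (Functions X) t).comp (gmCoaction X lam) = translate X lam t := by
  rw [translate, constGm_spec, coord_gm_smul]
  · ext a
    exact LaurentPolynomial.eval₂_C _ _ _
  · intro n
    rw [AlgHom.comp_apply, gmEval_T]
    have h := laurentEval_C_mul_T (A := Functions X) t 1 n
    rw [map_one, one_mul] at h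
    rw [h, Algebra.smul_def, mul_one]
    rfl

lemma coord_constGm_smul (lam : Gm k ⟶ G) (t : kˣ) (x : specOver k R ⟶ X) :
    coord ((constGm (specOver k R) t ≫ lam) • x) = (coord x).comp (translate X lam t) := by
  rw [translate, ← coord_specMap_comp, ModObj.comp_smul, ← Category.assoc, comp_constGm,
    specMap_ofCoord, AlgHom.comp_id, ofCoord_coord]

lemma isGmAction_gmCoaction (lam : Gm k ⟶ G) [IsMonHom lam] : IsGmAction (gmCoaction X lam) where
  one a := by
    have h := AlgHom.congr_fun (laurentEval_comp_gmCoaction (X := X) lam 1) a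
    rw [translate, constGm_one, MonObj.one_comp, one_smul, coord_ofCoord] at h
    exact h
  mul s t a := by
    have h (s : kˣ) (a) := AlgHom.congr_fun (laurentEval_comp_gmCoaction (X := X) lam s) a
    simp only [AlgHom.comp_apply] at h
    -- Pullback of functions reverses the order of translations, which is harmless because `kˣ` is
    -- commutative.
    rw [h, h, h, mul_comm]
    conv_rhs => rw [translate, ← constGm_mul, MonObj.mul_comp, mul_smul, coord_constGm_smul,
      coord_constGm_smul, coord_ofCoord]
    rfl

end Torus

/-! ### The Lie algebra, its weights and stabilisers of limits -/

section LieAlgebra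

open scoped TensorProduct

variable {k : Type u} [Field k] {R A : Type u} [CommRing R] [Algebra k R] [CommRing A] [Algebra k A]
  {U G X : Sch k} [GrpObj U] [GrpObj G] [ModObj G X] [IsAffine U.left] [IsAffine X.left]

lemma mem_lie_iff (v : SpecDual k ⟶ U) :
    v ∈ lie U ↔ ∀ g, (coord v g).fst = counitHom U g := by
  have h1 : v ∈ lie U ↔ specMap (TrivSqZeroExt.fstHom k k k) ≫ v = 1 := by
    constructor
    · intro h
      have h2 := congrArg (toUnit (specOver k k) ≫ ·) h
      simp only [dualPoint, ← Category.assoc, toUnit_specPoint, MonObj.comp_one] at h2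
      exact h2
    · intro h
      rw [lie, Set.mem_ofPred_eq, dualPoint, specPoint_eq, Category.assoc, h, MonObj.comp_one]
  rw [h1]
  constructor
  · intro h g
    have h2 := congrArg coord h
    rw [coord_specMap_comp] at h2
    exact AlgHom.congr_fun h2 g
  · intro h
    apply coord_injective
    rw [coord_specMap_comp]
    ext g
    exact h g

/-- The derivation at the identity that an element of the Lie algebra gives. -/
noncomputable def tangent (v : SpecDual k ⟶ U) : Functions U →ₗ[k] k :=
  (TrivSqZeroExt.sndHom k k).comp (coord v).toLinearMap

lemma tangent_apply (v : SpecDual k ⟶ U) (g : Functions U) : tangent v g = (coord v g).snd := rfl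

lemma tangent_mem_pointDer {v : SpecDual k ⟶ U} (hv : v ∈ lie U) :
    tangent v ∈ pointDer (counitHom U) := by
  rw [mem_lie_iff] at hv
  intro g h
  rw [tangent_apply, map_mul, TrivSqZeroExt.snd_mul, hv, hv, op_smul_eq_smul]
  rfl

lemma mul_mem_lie {v w : SpecDual k ⟶ U} (hv : v ∈ lie U) (hw : w ∈ lie U) : v * w ∈ lie U := by
  rw [lie, Set.mem_ofPred_eq] at *
  rw [MonObj.comp_mul, hv, hw, mul_one]

lemma inv_mem_lie {v : SpecDual k ⟶ U} (hv : v ∈ lie U) : v⁻¹ ∈ lie U := by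
  rw [lie, Set.mem_ofPred_eq] at *
  rw [GrpObj.comp_inv, hv, inv_one]

lemma one_mem_lie : (1 : SpecDual k ⟶ U) ∈ lie U := by
  rw [lie, Set.mem_ofPred_eq, MonObj.comp_one]

lemma tangent_one : tangent (1 : SpecDual k ⟶ U) = 0 := by
  ext g
  rw [tangent_apply, coord_one]
  rfl

/-- In the dual numbers the `ε`-part of a product is the sum of two cross terms, and the two counit
laws evaluate one each. -/
lemma tangent_mul {v w : SpecDual k ⟶ U} (hv : v ∈ lie U) (hw : w ∈ lie U) :
    tangent (v * w) = tangent v + tangent w := by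
  rw [mem_lie_iff] at hv hw
  ext g
  rw [LinearMap.add_apply, tangent_apply, coord_mul]
  have h : ∀ b : Functions U ⊗[k] Functions U,
      (Algebra.TensorProduct.productMap (coord v) (coord w) b).snd =
      tangent v (TensorProduct.rid k _ ((counitHom U).toLinearMap.lTensor _ b)) +
      tangent w (contract (counitHom U).toLinearMap _ b) := by
    intro b
    induction b with
    | zero => simp
    | add x y hx hy => simp only [map_add, TrivSqZeroExt.snd_add, hx, hy]; ring
    | tmul x y =>
      simp [contract_tmul, tangent_apply, hv, hw, add_comm, mul_comm]
  rw [AlgHom.comp_apply, h, rid_lTensor_counitHom, isCoaction_comulHom.counit]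

lemma tangent_inv {v : SpecDual k ⟶ U} (hv : v ∈ lie U) : tangent v⁻¹ = -tangent v := by
  rw [eq_neg_iff_add_eq_zero, ← tangent_mul (inv_mem_lie hv) hv, inv_mul_cancel, tangent_one]

/-- The element of the Lie algebra that a derivation at the identity gives. -/
noncomputable def ofTangent (p : pointDer (counitHom U)) : SpecDual k ⟶ U :=
  ofCoord (AlgHom.ofLinearMap
    ((TrivSqZeroExt.inlAlgHom k k k).toLinearMap.comp (counitHom U).toLinearMap +
      (TrivSqZeroExt.inrHom k k).comp p.1)
    (by
      ext
      · simp
      · simpa using pointDer_one p.2)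
    (by
      intro g h
      ext
      · simp
      · simpa [mul_comm] using p.2 g h))

lemma coord_ofTangent_fst (p : pointDer (counitHom U)) (g : Functions U) :
    (coord (ofTangent p) g).fst = counitHom U g := by
  rw [ofTangent, coord_ofCoord]
  simp

lemma coord_ofTangent_snd (p : pointDer (counitHom U)) (g : Functions U) :
    (coord (ofTangent p) g).snd = p.1 g := by
  rw [ofTangent, coord_ofCoord]
  simp

lemma ofTangent_mem_lie (p : pointDer (counitHom U)) : ofTangent p ∈ lie U :=
  (mem_lie_iff _).2 (coord_ofTangent_fst p)

/-- The derivations at the identity given by the vectors of strictly positive weight. -/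
def positiveTangents (incl : U ⟶ G) (lam : Gm k ⟶ G) : Set (Functions U →ₗ[k] k) :=
  {p | ∃ n : ℤ, 0 < n ∧ ∃ w ∈ lieWeight incl lam n, tangent w = p}

lemma positiveTangents_subset (incl : U ⟶ G) (lam : Gm k ⟶ G) :
    positiveTangents incl lam ⊆ pointDer (counitHom U) := by
  rintro p ⟨n, -, w, hw, rfl⟩
  exact tangent_mem_pointDer hw.1

/-- Positivity is a statement about the group `U(k[ε])`. Taking tangents turns its products into
sums, and every point derivation is the tangent of an element of the Lie algebra. -/
lemma pointDer_le_span_positiveTangents {incl : U ⟶ G} {lam : Gm k ⟶ G}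
    (hpos : ∀ v ∈ lie U,
      v ∈ Subgroup.closure {w | ∃ n : ℤ, 0 < n ∧ w ∈ lieWeight incl lam n}) :
    pointDer (counitHom U) ≤ Submodule.span k (positiveTangents incl lam) := by
  have h : ∀ v ∈ Subgroup.closure {w | ∃ n : ℤ, 0 < n ∧ w ∈ lieWeight incl lam n},
      v ∈ lie U ∧ tangent v ∈ Submodule.span k (positiveTangents incl lam) := by
    intro v hv
    induction hv using Subgroup.closure_induction with
    | mem w hw =>
      obtain ⟨n, hn, hw⟩ := hw
      exact ⟨hw.1, Submodule.subset_span ⟨n, hn, w, hw, rfl⟩⟩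
    | one => exact ⟨one_mem_lie, by rw [tangent_one]; exact zero_mem _⟩
    | mul v w _ _ hv hw =>
      exact ⟨mul_mem_lie hv.1 hw.1, by
        rw [tangent_mul hv.1 hw.1]; exact add_mem hv.2 hw.2⟩
    | inv v _ hv =>
      exact ⟨inv_mem_lie hv.1, by rw [tangent_inv hv.1]; exact neg_mem hv.2⟩
  intro p hp
  have h2 : tangent (ofTangent ⟨p, hp⟩) = p := by
    ext g
    rw [tangent_apply, coord_ofTangent_snd]
  rw [← h2]
  exact (h _ (hpos _ (ofTangent_mem_lie _))).2

lemma tangent_dualScale (c : k) (v : SpecDual k ⟶ U) :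
    tangent (dualScale c ≫ v) = c • tangent v := by
  ext g
  rw [tangent_apply, dualScale, coord_specMap_comp, LinearMap.smul_apply, tangent_apply]
  simp

lemma contract_productMap {B C : Type u} [CommRing B] [Algebra k B] [CommRing C] [Algebra k C]
    {H : Type u} [CommRing H] [Algebra k H]
    (p : C →ₗ[k] k) (f : H →ₐ[k] C) (g : A →ₐ[k] B) (b : H ⊗[k] A) :
    contract p B (Algebra.TensorProduct.productMap (Algebra.TensorProduct.includeLeft.comp f)
      (Algebra.TensorProduct.includeRight.comp g) b) =
      g (contract (p.comp f.toLinearMap) A b) := by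
  induction b with
  | zero => simp
  | add x y hx hy => simp only [map_add, hx, hy]
  | tmul x y => simp [contract_tmul]

/-- Both sides of `h` act on the universal point of `X` over `R ⊗ Functions X`, and the factor `R`
is then contracted with `p`. For the dual numbers and the `ε`-part this gives the relation between
derivations and translations. -/
lemma contract_translate {incl : U ⟶ G} {lam : Gm k ⟶ G} (p : R →ₗ[k] k)
    {w w' : specOver k R ⟶ U} {t : kˣ}
    (h : (constGm _ t ≫ lam) * (w ≫ incl) = (w' ≫ incl) * (constGm _ t ≫ lam))
    (a : Functions X) :
    contract (p.comp (coord w).toLinearMap) _ (coactionHom X incl (translate X lam t a)) =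
      translate X lam t
        (contract (p.comp (coord w').toLinearMap) _ (coactionHom X incl a)) := by
  let i : R →ₐ[k] R ⊗[k] Functions X := Algebra.TensorProduct.includeLeft
  let x : specOver k (R ⊗[k] Functions X) ⟶ X :=
    ofCoord Algebra.TensorProduct.includeRight
  have h1 := congrArg (specMap i ≫ ·) h
  simp only [MonObj.comp_mul, ← Category.assoc, comp_constGm] at h1
  have h3 := congrArg (fun y => coord (y • x)) h1
  simp only [mul_smul] at h3
  rw [coord_constGm_smul, coord_smul, coord_smul, coord_constGm_smul, coord_specMap_comp,
    coord_specMap_comp] at h3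
  have h4 := congrArg (contract p (Functions X)) (AlgHom.congr_fun h3 a)
  simp only [x, coord_ofCoord] at h4
  simp only [AlgHom.comp_apply] at h4
  rw [contract_productMap] at h4
  have h5 := contract_productMap p (coord w) (AlgHom.id k _)
    (coactionHom X incl (translate X lam t a))
  rw [AlgHom.comp_id] at h5
  exact h5.symm.trans h4

lemma coDer_translate {incl : U ⟶ G} [IsMonHom incl] {lam : Gm k ⟶ G} {n : ℤ}
    {w : SpecDual k ⟶ U} (hw : w ∈ lieWeight incl lam n) (t : kˣ) (a : Functions X) :
    coDer (isCoaction_coactionHom (X := X) incl) ⟨tangent w, tangent_mem_pointDer hw.1⟩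
        (translate X lam t a) =
      ((t ^ n : kˣ) : k) • translate X lam t
        (coDer (isCoaction_coactionHom (X := X) incl) ⟨tangent w, tangent_mem_pointDer hw.1⟩ a) := by
  have h := mul_inv_eq_iff_eq_mul.1 (hw.2 t)
  rw [← Category.assoc] at h
  refine (contract_translate (TrivSqZeroExt.sndHom k k) h a).trans ?_
  have h6 : (TrivSqZeroExt.sndHom k k).comp (coord (dualScale ((t ^ n : kˣ) : k) ≫ w)).toLinearMap =
    _ := tangent_dualScale ((t ^ n : kˣ) : k) w
  rw [h6, contract_smul, map_smul]
  rfl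

lemma coeff_toLaurent_natCast (p : Polynomial R) (n : ℕ) :
    (Polynomial.toLaurent p).coeff (n : ℤ) = p.coeff n := by
  induction p using Polynomial.induction_on' with
  | add p q hp hq => simp only [map_add, Polynomial.coeff_add, ← hp, ← hq]; rfl
  | monomial m a =>
    rw [← Polynomial.C_mul_X_pow_eq_monomial, Polynomial.toLaurent_C_mul_X_pow, coeff_C_mul_T,
      Polynomial.coeff_C_mul_X_pow]
    simp only [Nat.cast_inj, eq_comm]

lemma coeff_toLaurent_of_neg (p : Polynomial R) {n : ℤ} (hn : n < 0) :
    (Polynomial.toLaurent p).coeff n = 0 := by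
  induction p using Polynomial.induction_on' with
  | add p q hp hq =>
    rw [map_add]
    exact (congrArg₂ (· + ·) hp hq).trans (add_zero 0)
  | monomial m a =>
    rw [← Polynomial.C_mul_X_pow_eq_monomial, Polynomial.toLaurent_C_mul_X_pow, coeff_C_mul_T,
      if_neg (by lia)]

lemma hasFreeLimits {incl : U ⟶ G} [IsMonHom incl] {lam : Gm k ⟶ G}
    (hlim : ∀ x : 𝟙_ (Sch k) ⟶ X, ∃ z, IsLimitAtZero lam x z)
    (hstab : ∀ z ∈ limitSet X lam, HasTrivialStabilizer incl z) :
    HasFreeLimits (counitHom U) (coactionHom X incl) (gmCoaction X lam) where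
  exists_limit x := by
    obtain ⟨z', f, hf, hz⟩ := hlim (specPoint (AlgHom.id k k) ≫ ofCoord x)
    have hpt {R : Type u} [CommRing R] [Algebra k R] (x : Functions X →ₐ[k] k) :
        toUnit (specOver k R) ≫ specPoint (AlgHom.id k k) ≫ ofCoord x =
          ofCoord ((Algebra.ofId k R).comp x) := by
      rw [← Category.assoc, toUnit_specPoint, AlgHom.comp_id, specMap_ofCoord]
    -- The orbit map of `x` has comorphism `x` applied to the coefficients of the coaction. That it
    -- extends to the affine line means that these Laurent polynomials are polynomials, and the
    -- limit is their constant term.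
    have h1 : Polynomial.toLaurentAlg.comp (coord f) =
        (AddMonoidAlgebra.mapAlgHom ℤ x).comp (gmCoaction X lam) := by
      rw [← coord_specMap_comp]
      refine (congrArg coord hf).trans ?_
      rw [orbitMap, lift_actionVia, hpt, ← specMap_id]
      refine coord_gm_smul lam _ _ ?_ _ fun n => ?_
      · refine AlgHom.ext fun a => ?_
        exact AddMonoidAlgebra.mapAlgHom_single (M := ℤ) x 0 a
      · exact ((AddMonoidAlgebra.mapAlgHom_single (M := ℤ) x n 1).trans
          (by rw [map_one]; rfl)).symm
    have h2 (n : ℤ) (a : Functions X) :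
        x ((gmCoaction X lam a).coeff n) = (Polynomial.toLaurent (coord f a)).coeff n :=
      (congrArg (fun p : k[T;T⁻¹] => p.coeff n) (AlgHom.congr_fun h1 a)).symm
    let z : Functions X →ₐ[k] k := (Polynomial.aeval (0 : k)).comp (coord f)
    have hz' : z' = specPoint (AlgHom.id k k) ≫ ofCoord z := by
      rw [← hz, lineZero, specPoint_eq, Category.assoc]
      congr 1
      apply coord_injective
      rw [coord_specMap_comp, coord_ofCoord]
    refine ⟨z, fun a => ?_, fun n hn a => ?_, fun q hq h => ?_⟩
    · rw [h2, ← Int.natCast_zero, coeff_toLaurent_natCast, Polynomial.coeff_zero_eq_aeval_zero]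
      rfl
    · rw [h2, coeff_toLaurent_of_neg _ hn]
    · have hst := hstab z' ⟨_, f, hf, hz⟩
      -- The `k[ε]`-point of `U` given by `q` fixes the limit: the vanishing of `z` on derivatives
      -- along `q` is the equation for the `ε`-part. Triviality of the scheme-theoretic stabiliser
      -- then makes this point the identity.
      have h3 : ofTangent ⟨q, hq⟩ ≫ orbitMap incl z' = toUnit (SpecDual k) ≫ z' := by
        rw [orbitMap, ← Category.assoc, comp_lift, Category.comp_id, lift_actionVia,
          ← Category.assoc (ofTangent _) (toUnit _), toUnit_unique (ofTangent _ ≫ _) (toUnit _),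
          hz', hpt]
        apply coord_injective
        rw [coord_smul, coord_ofCoord]
        ext a
        · have h4 (b : Functions U ⊗[k] Functions X) :
              (Algebra.TensorProduct.productMap (coord (ofTangent ⟨q, hq⟩))
                ((Algebra.ofId k (DualNumber k)).comp z) b).fst =
                z (contract (counitHom U).toLinearMap _ b) := by
            induction b with
            | zero => simp
            | add x y hx hy => simp only [map_add, TrivSqZeroExt.fst_add, hx, hy]
            | tmul g a => simp [contract_tmul, coord_ofTangent_fst, Algebra.ofId_apply,
                TrivSqZeroExt.algebraMap_eq_inl]
          rw [AlgHom.comp_apply, h4, (isCoaction_coactionHom incl).counit]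
          simp [Algebra.ofId_apply, TrivSqZeroExt.algebraMap_eq_inl]
        · have h4 (b : Functions U ⊗[k] Functions X) :
              (Algebra.TensorProduct.productMap (coord (ofTangent ⟨q, hq⟩))
                ((Algebra.ofId k (DualNumber k)).comp z) b).snd =
                z (contract q _ b) := by
            induction b with
            | zero => simp
            | add x y hx hy => simp only [map_add, TrivSqZeroExt.snd_add, hx, hy]
            | tmul g a => simp [contract_tmul, coord_ofTangent_snd, Algebra.ofId_apply,
                TrivSqZeroExt.algebraMap_eq_inl, mul_comm]
          rw [AlgHom.comp_apply, h4, h]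
          simp [Algebra.ofId_apply, TrivSqZeroExt.algebraMap_eq_inl]
      have h5 : ofTangent ⟨q, hq⟩ = 1 := by
        rw [← hst.lift_fst _ (toUnit (SpecDual k)) (h3.trans (by simp)), Hom.one_def]
        congr 1
        exact toUnit_unique _ _
      ext g
      rw [← coord_ofTangent_snd ⟨q, hq⟩ g, h5, coord_one]
      rfl

end LieAlgebra

/-! ### From the retraction to the trivial quotient -/

section Quotient

open scoped TensorProduct

variable {k : Type u} [Field k] {U G X Y : Sch k}

/-- The map `s` built from the two projections satisfies `s ≫ universalPair X Y = 𝟙`. The other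
composite is dual to an endomorphism of the tensor product that fixes both factors, so it is the
identity as well. -/
instance isIso_universalPair [IsAffine X.left] [IsAffine Y.left] : IsIso (universalPair X Y) := by
  have : IsAffine (X ⊗ Y).left := inferInstanceAs (IsAffine (pullback X.hom Y.hom))
  let i : specOver k (Functions (X ⊗ Y)) ⟶ X ⊗ Y := inv (toSpecFunctions _)
  let s : X ⊗ Y ⟶ specOver k (Functions X ⊗[k] Functions Y) := toSpecFunctions _ ≫
    specMap (Algebra.TensorProduct.productMap (coord (i ≫ fst X Y)) (coord (i ≫ snd X Y)))
  have hs : s ≫ universalPair X Y = 𝟙 _ := by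
    rw [Category.assoc, specMap_productMap_universalPair, ← comp_lift, lift_fst_snd,
      Category.comp_id, IsIso.hom_inv_id]
  have : IsAffine (specOver k (Functions X ⊗[k] Functions Y)).left :=
    inferInstanceAs (IsAffine (Spec _))
  let f := (coord (universalPair X Y ≫ s)).comp (specFunctions k _).symm.toAlgHom
  have hf : specMap f = universalPair X Y ≫ s := by
    apply coord_injective
    rw [coord_specMap]
    ext a
    simp [f]
  have h1 : specMap f ≫ universalPair X Y = universalPair X Y := by
    rw [hf, Category.assoc, hs, Category.comp_id]
  have h2 : f = AlgHom.id k _ := by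
    ext a
    · have h3 := congrArg (fun φ => coord (φ ≫ fst X Y) a) h1
      simpa [universalPair, specMap_ofCoord, coord_ofCoord] using h3
    · have h3 := congrArg (fun φ => coord (φ ≫ snd X Y) a) h1
      simpa [universalPair, specMap_ofCoord, coord_ofCoord] using h3
  exact ⟨s, by rw [← hf, h2, specMap_id], hs⟩

variable [GrpObj U] [GrpObj G] [ModObj G X] [IsAffine U.left] [IsAffine X.left]

lemma mem_invariants_iff (incl : U ⟶ G) (a : Functions X) :
    a ∈ invariants X incl ↔ a ∈ coinv (coactionHom X incl) := by
  have hinj : Function.Injective (coord (universalPair U X)) := by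
    have h : (pull (inv (universalPair U X))).comp (pull (universalPair U X)) = AlgHom.id k _ := by
      rw [← pull_comp, IsIso.inv_hom_id, pull_id]
    exact (specFunctions k _).injective.comp
      (Function.LeftInverse.injective (g := pull (inv (universalPair U X))) (AlgHom.congr_fun h))
  have h1 : a ∈ invariants X incl ↔ pull (actionVia X incl) a = pull (snd U X) a := Iff.rfl
  have h2 : coord (universalPair U X) (pull (snd U X) a) = 1 ⊗ₜ a := by
    rw [← AlgHom.comp_apply, ← coord_comp, universalPair, lift_snd, coord_ofCoord]
    rfl
  rw [h1, ← hinj.eq_iff, mem_coinv, h2, ← AlgHom.comp_apply, ← coord_comp, coactionHom]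

/-- The trivialisation is `(u, y) ↦ u • s(y)`, with comorphism `orbitHom`. It lies over `Y` because
functions pulled back along `q` are invariant and `s` is a section; it is equivariant by
associativity of the action. -/
lemma isTrivialQuotient_of_bijective_orbitHom [IsAffine Y.left] (incl : U ⟶ G) [IsMonHom incl]
    (q : X ⟶ Y) (s : Y ⟶ X) (hq : ∀ b, pull q b ∈ coinv (coactionHom X incl))
    (hs : s ≫ q = 𝟙 Y) (hb : Function.Bijective (orbitHom (coactionHom X incl) (pull s))) :
    IsTrivialQuotient incl q := by
  let e : U ⊗ Y ⟶ X := U ◁ s ≫ actionVia X incl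
  have he {T : Sch k} (u : T ⟶ U) (y : T ⟶ Y) : lift u y ≫ e = (u ≫ incl) • (y ≫ s) := by
    rw [lift_whiskerLeft_assoc, lift_actionVia]
  have hc : coord (universalPair U Y ≫ e) = orbitHom (coactionHom X incl) (pull s) := by
    rw [universalPair, he, coord_smul, coord_ofCoord, coord_comp, coord_ofCoord]
    refine AlgHom.ext fun a => ?_
    exact productMap_lTensor_eq _ _
  have h1 : IsIso (universalPair U Y ≫ e) := isIso_of_bijective_coord _ (hc ▸ hb)
  have h2 : IsIso e := IsIso.of_isIso_comp_left (universalPair U Y) e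
  refine ⟨asIso e, ?_, ?_⟩
  · rw [asIso_hom, ← cancel_epi (universalPair U Y)]
    apply coord_injective
    rw [← Category.assoc, coord_comp, hc, universalPair, lift_snd, coord_ofCoord]
    refine AlgHom.ext fun b => ?_
    have h3 := AlgHom.congr_fun (congrArg pull hs) b
    rw [pull_comp, pull_id] at h3
    rw [AlgHom.comp_apply, orbitHom_apply, mem_coinv.1 (hq b)]
    exact congrArg (fun c => (1 : Functions U) ⊗ₜ[k] c) h3
  · have h3 : U ◁ e = lift (fst U (U ⊗ Y)) (snd U (U ⊗ Y) ≫ e) := by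
      ext <;> simp
    have h4 : (α_ U U Y).inv ≫ μ[U] ▷ Y =
        lift (fst U (U ⊗ Y) * (snd U (U ⊗ Y) ≫ fst U Y)) (snd U (U ⊗ Y) ≫ snd U Y) := by
      apply CartesianMonoidalCategory.hom_ext
      · rw [Hom.mul_def, Category.assoc, whiskerRight_fst, ← Category.assoc, lift_fst]
        congr 1
        apply CartesianMonoidalCategory.hom_ext
        · rw [Category.assoc, associator_inv_fst_fst, lift_fst]
        · rw [Category.assoc, associator_inv_fst_snd, lift_snd]
      · rw [Category.assoc, whiskerRight_snd, associator_inv_snd, lift_snd]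
    have h5 : snd U (U ⊗ Y) ≫ e = lift (snd U (U ⊗ Y) ≫ fst U Y) (snd U (U ⊗ Y) ≫ snd U Y) ≫ e := by
      rw [← comp_lift, lift_fst_snd, Category.comp_id]
    rw [asIso_hom, ← Category.assoc, h4, he, h3, lift_actionVia, h5, he, MonObj.mul_comp, mul_smul]

lemma bijective_orbitHom_comp {H A B C : Type*} [CommRing H] [Algebra k H] [CommRing A]
    [Algebra k A] [CommRing B] [Algebra k B] [CommRing C] [Algebra k C] (co : A →ₐ[k] H ⊗[k] A)
    {r : A →ₐ[k] B} (hr : Function.Bijective (orbitHom co r)) (e : B ≃ₐ[k] C) :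
    Function.Bijective (orbitHom co (e.toAlgHom.comp r)) := by
  have h : orbitHom co (e.toAlgHom.comp r) =
      (Algebra.TensorProduct.congr (AlgEquiv.refl (R := k) (A₁ := H)) e).toAlgHom.comp
        (orbitHom co r) := by
    refine AlgHom.ext fun a => ?_
    rw [AlgHom.comp_apply, orbitHom_apply, orbitHom_apply]
    generalize co a = b
    induction b with
    | zero => simp
    | add x y hx hy => simp only [map_add, hx, hy]
    | tmul x y => simp
  rw [h]
  exact (Algebra.TensorProduct.congr (AlgEquiv.refl (R := k) (A₁ := H)) e).bijective.comp hr

variable [IsAlgClosed k] [CharZero k]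

lemma exists_retraction_of_hasFreeLimits {incl : U ⟶ G} {lam : Gm k ⟶ G}
    (hG : IsGradedUnipotent incl lam) [IsMonHom incl] [LocallyOfFiniteType X.hom]
    (hl : HasFreeLimits (counitHom U) (coactionHom X incl) (gmCoaction X lam)) :
    ∃ r : Functions X →ₐ[k] coinv (coactionHom X incl),
      (∀ c : coinv (coactionHom X incl), r c = c) ∧
        Function.Bijective (orbitHom (coactionHom X incl) r) := by
  classical
  have := hG.isMonHom
  have := finiteType_functions X
  obtain ⟨n, M, hM⟩ := hG.unipotent.exists_isUnitriangular
  obtain ⟨T, hT, _, hli, hsp⟩ := exists_finite_basis_of_span hM (positiveTangents_subset incl lam)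
    (pointDer_le_span_positiveTangents hG.positive)
  have := Fintype.ofFinite T
  choose w hw v hv hvt using fun j : T => hT j.2
  let p : T → pointDer (counitHom U) := fun j => ⟨tangent (v j), tangent_mem_pointDer (hv j).1⟩
  have hp : (fun j => (p j).1) = ((↑) : T → Functions U →ₗ[k] k) := funext hvt
  obtain ⟨f, W, hW, hnil⟩ := exists_slices (isGmAction_gmCoaction lam) hl
    (hco := isCoaction_coactionHom incl) (p := p) (hp ▸ hli) hw fun j t a => by
      have h (a) := AlgHom.congr_fun (laurentEval_comp_gmCoaction (X := X) lam t) a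
      simp only [AlgHom.comp_apply] at h
      rw [h, h]
      exact coDer_translate (hv j) t a
  exact exists_retraction_bijective_orbitHom (isCoaction_coactionHom incl) hM
    rid_lTensor_counitHom isCoaction_comulHom (hp ▸ hli) (hp ▸ hsp) hW hnil

end Quotient

end GradedUnipotent

theorem proposition4p6 {k : Type u} [Field k] [IsAlgClosed k] [CharZero k]
    {U G : GradedUnipotent.Sch k} [GrpObj U] [GrpObj G]
    (incl : U ⟶ G) (lam : GradedUnipotent.Gm k ⟶ G)
    (hG : GradedUnipotent.IsGradedUnipotent incl lam)
    (X : GradedUnipotent.Sch k) [IsAffine X.left] [LocallyOfFiniteType X.hom] [ModObj G X]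
    (hlim : ∀ x : 𝟙_ (GradedUnipotent.Sch k) ⟶ X, ∃ z, GradedUnipotent.IsLimitAtZero lam x z)
    (hstab : ∀ z ∈ GradedUnipotent.limitSet X lam, GradedUnipotent.HasTrivialStabilizer incl z) :
    (GradedUnipotent.invariantsStructureMap X incl).FiniteType ∧
      GradedUnipotent.IsTrivialQuotient incl (GradedUnipotent.quotientMap X incl) := by
  have := hG.normal.isMonHom
  have := hG.unipotent.isAffine
  obtain ⟨r, hr, hb⟩ := GradedUnipotent.exists_retraction_of_hasFreeLimits hG
    (GradedUnipotent.hasFreeLimits hlim hstab)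
  let _ : Algebra k (GradedUnipotent.invariants X incl) :=
    (GradedUnipotent.invariantsStructureMap X incl).toAlgebra
  let e : GradedUnipotent.coinv (GradedUnipotent.coactionHom X incl) ≃ₐ[k]
      GradedUnipotent.invariants X incl :=
    { toFun := fun c => ⟨c.1, (GradedUnipotent.mem_invariants_iff incl _).2 c.2⟩
      invFun := fun c => ⟨c.1, (GradedUnipotent.mem_invariants_iff incl _).1 c.2⟩
      left_inv := fun _ => rfl
      right_inv := fun _ => rfl
      map_mul' := fun _ _ => rfl
      map_add' := fun _ _ => rfl
      commutes' := fun _ => rfl }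
  constructor
  · have := GradedUnipotent.finiteType_functions X
    -- The retraction presents the invariants as a quotient of the finitely generated algebra of
    -- functions on `X`.
    refine Algebra.FiniteType.of_surjective (e.toAlgHom.comp r) fun c => ?_
    exact ⟨e.symm c, (congrArg e (hr (e.symm c))).trans (e.apply_symm_apply c)⟩
  · let v : GradedUnipotent.invariants X incl →ₐ[k] GradedUnipotent.Functions X :=
      { (GradedUnipotent.invariants X incl).subtype with commutes' := fun _ => rfl }
    let Y := GradedUnipotent.specOver k (GradedUnipotent.invariants X incl)
    have : IsAffine Y.left := inferInstanceAs (IsAffine (Spec _))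
    -- This agrees with `quotientMap X incl` by unfolding definitions; the retraction provides its
    -- section `s`.
    let q : X ⟶ Y := GradedUnipotent.toSpecFunctions X ≫ GradedUnipotent.specMap v
    let s : Y ⟶ X := GradedUnipotent.ofCoord (e.toAlgHom.comp r)
    let f := GradedUnipotent.specFunctions k (GradedUnipotent.invariants X incl)
    have hq (b) : GradedUnipotent.pull q b = v (f b) := by
      rw [GradedUnipotent.pull_comp, GradedUnipotent.pull_toSpecFunctions]
      exact GradedUnipotent.specFunctions_pull v b
    have hs : GradedUnipotent.coord s = e.toAlgHom.comp r := GradedUnipotent.coord_ofCoord _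
    have hs' : GradedUnipotent.pull s = (e.trans f.symm).toAlgHom.comp r := by
      refine AlgHom.ext fun a => f.injective ?_
      refine (AlgHom.congr_fun hs a).trans ?_
      exact (f.apply_symm_apply _).symm
    refine GradedUnipotent.isTrivialQuotient_of_bijective_orbitHom (Y := Y) incl q s
      (fun b => ?_) ?_ ?_
    · rw [hq]
      exact (GradedUnipotent.mem_invariants_iff incl _).1 (f b).2
    · apply GradedUnipotent.coord_injective
      rw [GradedUnipotent.coord_comp, hs]
      refine AlgHom.ext fun b => ?_
      rw [AlgHom.comp_apply, hq]
      refine (congrArg e (hr (e.symm (f b)))).trans ((e.apply_symm_apply _).trans ?_)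
      rw [GradedUnipotent.coord, GradedUnipotent.pull_id]
      rfl
    · rw [hs']
      exact GradedUnipotent.bijective_orbitHom_comp _ hb _
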